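/- **Theorem 5.2.** Let $N,n,m\in\mathbb N$ and let $(\Omega,\mathcal A,\mathbb P)$ be a probability space with a filtration $(\mathfrak F_k)_{k\ge 0}$. Let $\omega_0,\dots,\omega_{N-1}$ be square integrable real random variables such that $\omega_k$ is $\mathfrak F_{k+1}$-measurable, $\mathbb E[\omega_k\mid\mathfrak F_k]=0$ and $\mathbb E[\omega_k^2\mid\mathfrak F_k]=1$. Let $A_k,\bar A_k,C_k,\bar C_k\in\mathbb R^{n\times n}$, $B_k,\bar B_k,D_k,\bar D_k\in\mathbb R^{n\times m}$, $S_k,\bar S_k\in\mathbb R^{m\times n}$, and let $Q_k,\bar Q_k\in\mathbb R^{n\times n}$, $R_k,\bar R_k\in\mathbb R^{m\times m}$, $G,\bar G\in\mathbb R^{n\times n}$ be symmetric $(0\le k<N)$. For $0\le l\le N$, an initial state at time $l$ is a square integrable, $\mathfrak F_l$-measurable $\xi$ that is independent of $(\omega_0,\dots,\omega_{N-1})$; assume that a real-valued, not almost surely constant such variable exists at time $0$. Let $\mathscr U_{ad}=\mathscr U_{ad}(l)$ be the set of controls $u=(u_l,\dots,u_{N-1})$ with $u_k$ an $\mathfrak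 F_k$-measurable, square integrable $\mathbb R^m$-valued random variable. For an $\mathbb R^n$-valued initial state $\xi$ at time $l$ and $u\in\mathscr U_{ad}$ let $x_l=\xi$, $$x_{k+1}=A_kx_k+\bar A_k\mathbb Ex_k+B_ku_k+\bar B_k\mathbb Eu_k+(C_kx_k+\bar C_k\mathbb Ex_k+D_ku_k+\bar D_k\mathbb Eu_k)\,\omega_k,\qquad l\le k<N,$$ $$J^0(l,\xi;u)=\mathbb E\Big\{\langle Gx_N,x_N\rangle+\langle\bar G\mathbb Ex_N,\mathbb Ex_N\rangle+\sum_{k=l}^{N-1}\Big[\Big\langle\begin{pmatrix}Q_k&S_k'\\S_k&R_k\end{pmatrix}\begin{pmatrix}x_k\\u_k\end{pmatrix},\begin{pmatrix}x_k\\u_k\end{pmatrix}\Big\rangle+\Big\langle\begin{pmatrix}\bar Q_k&\bar S_k'\\\bar S_k&\bar R_k\end{pmatrix}\begin{pmatrix}\mathbb Ex_k\\\mathbb Eu_k\end{pmatrix},\begin{pmatrix}\mathbb Ex_k\\\mathbb Eu_k\end{pmatrix}\Big\rangle\Big]\Big\},$$ and $V^0(l,\xi)=\inf_{u\in\mathscr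 U_{ad}}J^0(l,\xi;u)\in[-\infty,\infty]$; thus $V^0(N,\xi)=\mathbb E\langle G\xi,\xi\rangle+\langle\bar G\mathbb E\xi,\mathbb E\xi\rangle$. Assume that the problem is finite, i.e. $V^0(l,\xi)>-\infty$ for all $0\le l<N$ and all $\mathbb R^n$-valued initial states $\xi$ at time $l$, and let $P_0,\dots,P_N,\Pi_0,\dots,\Pi_N$ be symmetric matrices such that $$V^0(l,\xi)=\mathbb E\langle P_l(\xi-\mathbb E\xi),\xi-\mathbb E\xi\rangle+\langle\Pi_l\mathbb E\xi,\mathbb E\xi\rangle\tag{5.2}$$ for all $0\le l\le N$ and all $\mathbb R^n$-valued initial states $\xi$ at time $l$. Put $$\Upsilon_k=R_k+B_k'P_{k+1}B_k+D_k'P_{k+1}D_k,\qquad H_k=B_k'P_{k+1}A_k+D_k'P_{k+1}C_k+S_k,$$ $$\bar\Upsilon_k=R_k+\bar R_k+(B_k+\bar B_k)'\Pi_{k+1}(B_k+\bar B_k)+(D_k+\bar D_k)'P_{k+1}(D_k+\bar D_k),$$ $$\bar H_k=(B_k+\bar B_k)'\Pi_{k+1}(A_k+\bar A_k)+(D_k+\bar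 D_k)'P_{k+1}(C_k+\bar C_k)+S_k+\bar S_k .$$ If for some $\alpha>0$ one has $\Upsilon_k\ge\alpha I$ and $\bar\Upsilon_k\ge\alpha I$ for all $0\le k<N$, then $(P,\Pi)$ solves the generalized Riccati equations: with $\dagger$ the Moore–Penrose pseudo-inverse, for $0\le k<N$, $$P_k=Q_k+A_k'P_{k+1}A_k+C_k'P_{k+1}C_k-H_k'\Upsilon_k^\dagger H_k,$$ $$\Pi_k=Q_k+\bar Q_k+(A_k+\bar A_k)'\Pi_{k+1}(A_k+\bar A_k)+(C_k+\bar C_k)'P_{k+1}(C_k+\bar C_k)-\bar H_k'\bar\Upsilon_k^\dagger\bar H_k,$$ $$P_N=G,\qquad\Pi_N=G+\bar G .$$ Consequently $u\mapsto J^0(0,0;u)$ is uniformly convex on $\mathscr U_{ad}(0)$: there is $c>0$ such that $J^0(0,0;u)\ge c\,\mathbb E\sum_{k=0}^{N-1}|u_k|^2$ for all $u\in\mathscr U_{ad}(0)$, and $$J^0(0,0;tu+(1-t)v)\le tJ^0(0,0;u)+(1-t)J^0(0,0;v)-c\,t(1-t)\,\mathbb E\sum_{k=0}^{N-1}|u_k-v_k|^2$$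 for all $u,v\in\mathscr U_{ad}(0)$ and $t\in[0,1]$. -/

import Mathlib

open MeasureTheory ProbabilityTheory
open scoped Matrix

namespace MFLQ

/-- `X` is the Moore-Penrose pseudo-inverse of the real matrix `M` (the four Penrose equations;
such an `X` exists and is unique for every `M`). -/
structure IsMoorePenrose {p q : ℕ} (M : Matrix (Fin p) (Fin q) ℝ)
    (X : Matrix (Fin q) (Fin p) ℝ) : Prop where
  mul_mul_left : M * X * M = M
  mul_mul_right : X * M * X = X
  symm_left : (M * X).IsSymm
  symm_right : (X * M).IsSymm

/-- The uniqueness of the pseudo-inverse. -/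
theorem IsMoorePenrose.unique {p q : ℕ} {M : Matrix (Fin p) (Fin q) ℝ}
    {X Y : Matrix (Fin q) (Fin p) ℝ} (hX : IsMoorePenrose M X) (hY : IsMoorePenrose M Y) :
    X = Y := by
  have h1 : M * X = M * Y := by
    calc M * X = (M * X)ᵀ := hX.symm_left.symm
      _ = (M * Y * (M * X))ᵀ := by rw [← Matrix.mul_assoc, hY.mul_mul_left]
      _ = (M * X)ᵀ * (M * Y)ᵀ := Matrix.transpose_mul _ _
      _ = M * X * (M * Y) := by rw [hX.symm_left, hY.symm_left]
      _ = M * Y := by rw [← Matrix.mul_assoc, hX.mul_mul_left]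
  have h2 : X * M = Y * M := by
    calc X * M = (X * M)ᵀ := hX.symm_right.symm
      _ = (X * M * (Y * M))ᵀ := by
          rw [Matrix.mul_assoc, ← Matrix.mul_assoc M Y M, hY.mul_mul_left]
      _ = (Y * M)ᵀ * (X * M)ᵀ := Matrix.transpose_mul _ _
      _ = Y * M * (X * M) := by rw [hX.symm_right, hY.symm_right]
      _ = Y * M := by rw [Matrix.mul_assoc, ← Matrix.mul_assoc M X M, hX.mul_mul_left]
  calc X = X * M * X := hX.mul_mul_right.symm
    _ = Y * (M * X) := by rw [h2, Matrix.mul_assoc]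
    _ = Y * M * Y := by rw [h1, Matrix.mul_assoc]
    _ = Y := hY.mul_mul_right

/-- The coefficients of the homogeneous discrete-time mean-field linear quadratic problem with
state dimension `n`, control dimension `m` and horizon `N`. Only the coefficients with index
`k < N` matter. The suffix `b` stands for the bar: `Ab k` multiplies `𝔼 x_k`, and so on. -/
structure Data (n m N : ℕ) where
  A : ℕ → Matrix (Fin n) (Fin n) ℝ
  Ab : ℕ → Matrix (Fin n) (Fin n) ℝ
  B : ℕ → Matrix (Fin n) (Fin m) ℝ
  Bb : ℕ → Matrix (Fin n) (Fin m) ℝ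
  C : ℕ → Matrix (Fin n) (Fin n) ℝ
  Cb : ℕ → Matrix (Fin n) (Fin n) ℝ
  D : ℕ → Matrix (Fin n) (Fin m) ℝ
  Db : ℕ → Matrix (Fin n) (Fin m) ℝ
  Q : ℕ → Matrix (Fin n) (Fin n) ℝ
  Qb : ℕ → Matrix (Fin n) (Fin n) ℝ
  S : ℕ → Matrix (Fin m) (Fin n) ℝ
  Sb : ℕ → Matrix (Fin m) (Fin n) ℝ
  R : ℕ → Matrix (Fin m) (Fin m) ℝ
  Rb : ℕ → Matrix (Fin m) (Fin m) ℝ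
  G : Matrix (Fin n) (Fin n) ℝ
  Gb : Matrix (Fin n) (Fin n) ℝ
  Q_symm : ∀ k < N, (Q k).IsSymm
  Qb_symm : ∀ k < N, (Qb k).IsSymm
  R_symm : ∀ k < N, (R k).IsSymm
  Rb_symm : ∀ k < N, (Rb k).IsSymm
  G_symm : G.IsSymm
  Gb_symm : Gb.IsSymm

/-- The driving noise `ω_0, …, ω_{N-1}`: a square integrable martingale difference sequence with
conditional variance one. `ℱ k` is the information available just before `ω k` is revealed, that
is, the information on which the control `u_k` may depend. -/
structure IsNoise {Ω : Type*} {mΩ : MeasurableSpace Ω} (μ : Measure Ω) (ℱ : Filtration ℕ mΩ)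
    (ω : ℕ → Ω → ℝ) (N : ℕ) : Prop where
  adapted : ∀ k < N, Measurable[ℱ (k + 1)] (ω k)
  memLp : ∀ k < N, MemLp (ω k) 2 μ
  condExp_eq_zero : ∀ k < N, μ[ω k|ℱ k] =ᵐ[μ] fun _ => 0
  condExp_sq_eq_one : ∀ k < N, μ[fun a => ω k a ^ 2|ℱ k] =ᵐ[μ] fun _ => 1

/-- The admissible initial states at time `l`: known at time `l`, square integrable, and
independent of the noise `(ω_0, …, ω_{N-1})`. -/
structure IsInitialState {Ω E : Type*} {mΩ : MeasurableSpace Ω} [NormedAddCommGroup E]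
    [MeasurableSpace E] (μ : Measure Ω) (ℱ : Filtration ℕ mΩ) (ω : ℕ → Ω → ℝ) (N l : ℕ)
    (ξ : Ω → E) : Prop where
  measurable : Measurable[ℱ l] ξ
  memLp : MemLp ξ 2 μ
  indep : IndepFun ξ (fun a (k : Fin N) => ω k a) μ

/-- The admissible controls `(u_l, …, u_{N-1})` on `{l, …, N-1}`: each `u_k` is
`ℱ k`-measurable and square integrable. The values of `u` at other times play no role. -/
def admissible {Ω : Type*} {mΩ : MeasurableSpace Ω} (μ : Measure Ω) (ℱ : Filtration ℕ mΩ)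
    (m N l : ℕ) : Set (ℕ → Ω → Fin m → ℝ) :=
  {u | ∀ k, l ≤ k → k < N → Measurable[ℱ k] (u k) ∧ MemLp (u k) 2 μ}

section

variable {Ω : Type*} [MeasurableSpace Ω] {n m N : ℕ}

/-- The state process started from `x_l = ξ` (for indices `k < l` the value is `ξ` by convention;
it is never used). -/
noncomputable def state (d : Data n m N) (μ : Measure Ω) (ω : ℕ → Ω → ℝ) (l : ℕ)
    (ξ : Ω → Fin n → ℝ) (u : ℕ → Ω → Fin m → ℝ) : ℕ → Ω → Fin n → ℝ
  | 0 => ξ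
  | k + 1 =>
    if k < l then ξ
    else
      let x := state d μ ω l ξ u k
      fun a =>
        (d.A k *ᵥ x a + d.Ab k *ᵥ (∫ b, x b ∂μ) + d.B k *ᵥ u k a + d.Bb k *ᵥ (∫ b, u k b ∂μ))
        + ω k a • (d.C k *ᵥ x a + d.Cb k *ᵥ (∫ b, x b ∂μ)
            + d.D k *ᵥ u k a + d.Db k *ᵥ (∫ b, u k b ∂μ))

/-- The quadratic form of the block matrix `[[Q, Sᵀ], [S, R]]` at the vector `(x, u)`. -/
def blockForm (Q : Matrix (Fin n) (Fin n) ℝ) (S : Matrix (Fin m) (Fin n) ℝ)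
    (R : Matrix (Fin m) (Fin m) ℝ) (x : Fin n → ℝ) (u : Fin m → ℝ) : ℝ :=
  (Q *ᵥ x + Sᵀ *ᵥ u) ⬝ᵥ x + (S *ᵥ x + R *ᵥ u) ⬝ᵥ u

/-- The cost functional `J⁰(l, ξ; u)` of the homogeneous problem. -/
noncomputable def cost (d : Data n m N) (μ : Measure Ω) (ω : ℕ → Ω → ℝ) (l : ℕ)
    (ξ : Ω → Fin n → ℝ) (u : ℕ → Ω → Fin m → ℝ) : ℝ :=
  let x := state d μ ω l ξ u
  ∫ a, ((d.G *ᵥ x N a) ⬝ᵥ x N a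
      + (d.Gb *ᵥ (∫ b, x N b ∂μ)) ⬝ᵥ (∫ b, x N b ∂μ)
      + ∑ k ∈ Finset.Ico l N, blockForm (d.Q k) (d.S k) (d.R k) (x k a) (u k a)
      + ∑ k ∈ Finset.Ico l N, blockForm (d.Qb k) (d.Sb k) (d.Rb k)
          (∫ b, x k b ∂μ) (∫ b, u k b ∂μ)) ∂μ

/-- The squared norm `𝔼 ∑_{k=l}^{N-1} |u_k|²` of a control (`|·|` is the Euclidean norm). -/
noncomputable def energy (μ : Measure Ω) (N l : ℕ) (u : ℕ → Ω → Fin m → ℝ) : ℝ :=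
  ∫ a, ∑ k ∈ Finset.Ico l N, u k a ⬝ᵥ u k a ∂μ

/-- `Υ_k = R_k + B_k' P_{k+1} B_k + D_k' P_{k+1} D_k`. -/
def Upsilon (d : Data n m N) (P : ℕ → Matrix (Fin n) (Fin n) ℝ) (k : ℕ) :
    Matrix (Fin m) (Fin m) ℝ :=
  d.R k + (d.B k)ᵀ * P (k + 1) * d.B k + (d.D k)ᵀ * P (k + 1) * d.D k

/-- `Ῡ_k`, the analogue of `Υ_k` for the mean. -/
def UpsilonBar (d : Data n m N) (P Pi : ℕ → Matrix (Fin n) (Fin n) ℝ) (k : ℕ) :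
    Matrix (Fin m) (Fin m) ℝ :=
  d.R k + d.Rb k + (d.B k + d.Bb k)ᵀ * Pi (k + 1) * (d.B k + d.Bb k)
    + (d.D k + d.Db k)ᵀ * P (k + 1) * (d.D k + d.Db k)

/-- `H_k = B_k' P_{k+1} A_k + D_k' P_{k+1} C_k + S_k`. -/
def crossTerm (d : Data n m N) (P : ℕ → Matrix (Fin n) (Fin n) ℝ) (k : ℕ) :
    Matrix (Fin m) (Fin n) ℝ :=
  (d.B k)ᵀ * P (k + 1) * d.A k + (d.D k)ᵀ * P (k + 1) * d.C k + d.S k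

/-- `H̄_k`, the analogue of `H_k` for the mean. -/
def crossTermBar (d : Data n m N) (P Pi : ℕ → Matrix (Fin n) (Fin n) ℝ) (k : ℕ) :
    Matrix (Fin m) (Fin n) ℝ :=
  (d.B k + d.Bb k)ᵀ * Pi (k + 1) * (d.A k + d.Ab k)
    + (d.D k + d.Db k)ᵀ * P (k + 1) * (d.C k + d.Cb k) + (d.S k + d.Sb k)

/-- `(P, Π)` solves the generalized Riccati equations on `{0, …, N}`. -/
structure SolvesGRE (d : Data n m N) (P Pi : ℕ → Matrix (Fin n) (Fin n) ℝ) : Prop where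
  eq_P : ∀ k < N, ∃ X, IsMoorePenrose (Upsilon d P k) X ∧
    P k = d.Q k + (d.A k)ᵀ * P (k + 1) * d.A k + (d.C k)ᵀ * P (k + 1) * d.C k
      - (crossTerm d P k)ᵀ * X * crossTerm d P k
  eq_Pi : ∀ k < N, ∃ X, IsMoorePenrose (UpsilonBar d P Pi k) X ∧
    Pi k = d.Q k + d.Qb k + (d.A k + d.Ab k)ᵀ * Pi (k + 1) * (d.A k + d.Ab k)
      + (d.C k + d.Cb k)ᵀ * P (k + 1) * (d.C k + d.Cb k)
      - (crossTermBar d P Pi k)ᵀ * X * crossTermBar d P Pi k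
  terminal_P : P N = d.G
  terminal_Pi : Pi N = d.G + d.Gb

end

section

variable {Ω : Type*} {mΩ : MeasurableSpace Ω} {n m N : ℕ}

/-- The value function `V⁰(l, ξ)`, the infimum of the cost over the admissible controls, with
values in the extended reals. At `l = N` it is the terminal cost of `ξ`. -/
noncomputable def value (d : Data n m N) (μ : Measure Ω) (ℱ : Filtration ℕ mΩ)
    (ω : ℕ → Ω → ℝ) (l : ℕ) (ξ : Ω → Fin n → ℝ) : EReal :=
  ⨅ u ∈ admissible μ ℱ m N l, (cost d μ ω l ξ u : EReal)

/-- The homogeneous problem is finite: `V⁰(l, ξ) > -∞` for all initial pairs. -/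
def IsFiniteProblem (d : Data n m N) (μ : Measure Ω) (ℱ : Filtration ℕ mΩ)
    (ω : ℕ → Ω → ℝ) : Prop :=
  ∀ l < N, ∀ ξ : Ω → Fin n → ℝ, IsInitialState μ ℱ ω N l ξ → ⊥ < value d μ ℱ ω l ξ

/-- `V⁰(l, ξ) = 𝔼⟨P_l (ξ - 𝔼ξ), ξ - 𝔼ξ⟩ + ⟨Π_l 𝔼ξ, 𝔼ξ⟩` for all initial pairs, the terminal time
included. -/
def ValueRepresentation (d : Data n m N) (μ : Measure Ω) (ℱ : Filtration ℕ mΩ)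
    (ω : ℕ → Ω → ℝ) (P Pi : ℕ → Matrix (Fin n) (Fin n) ℝ) : Prop :=
  ∀ l ≤ N, ∀ ξ : Ω → Fin n → ℝ, IsInitialState μ ℱ ω N l ξ →
    value d μ ℱ ω l ξ =
      (((∫ a, (P l *ᵥ (ξ a - ∫ b, ξ b ∂μ)) ⬝ᵥ (ξ a - ∫ b, ξ b ∂μ) ∂μ)
        + (Pi l *ᵥ (∫ b, ξ b ∂μ)) ⬝ᵥ (∫ b, ξ b ∂μ) : ℝ) : EReal)

/-- Uniform convexity of `u ↦ J⁰(l, ξ; u)` with constant `c` on the admissible controls. -/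
def UniformlyConvexWith (d : Data n m N) (μ : Measure Ω) (ℱ : Filtration ℕ mΩ)
    (ω : ℕ → Ω → ℝ) (l : ℕ) (ξ : Ω → Fin n → ℝ) (c : ℝ) : Prop :=
  ∀ u ∈ admissible μ ℱ m N l, ∀ v ∈ admissible μ ℱ m N l, ∀ t ∈ Set.Icc (0 : ℝ) 1,
    cost d μ ω l ξ (t • u + (1 - t) • v)
      ≤ t * cost d μ ω l ξ u + (1 - t) * cost d μ ω l ξ v
        - c * (t * (1 - t)) * energy μ N l (u - v)

end

end MFLQ

/-! The proof rests on one exact identity, obtained by completing squares. Every second moment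
splits into a centred part and a mean part. The noise has conditional mean zero and conditional
variance one, so one step of the dynamics acts on these two parts separately (`meanForm_step`).
Completing the square in each part, with the invertible weights `Upsilon` and `UpsilonBar`, turns
the cost-to-go after step `k` plus the stage cost into a quadratic form in the current state, with
Riccati coefficients, plus `excess`: a quadratic expression in the distance of the control from a
linear feedback (`meanForm_step_add_stageCost`). Telescoping yields
`cost_eq_meanForm_add_sum_excess`.

The Riccati equations follow by backward induction. If they hold after time `l`, the cost from `l`
is the Riccati form of the initial state plus nonnegative excesses, and the feedback makes all of
these vanish. The value is therefore the Riccati form (`value_eq_meanForm_riccati`). Comparison with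
the assumed representation identifies the matrices: deterministic states determine `Pi`, and a state
with nonzero variance then determines `P` (`eq_of_meanForm_eq`). Since both weights are at least
`α`, they are invertible and the pseudo-inverse is the ordinary inverse.

For zero initial state the cost is now exactly the sum of the excesses, hence at least `α` times the
sum of the squared deviations from feedback. The control can be recovered from its deviations step
by step, with bounds (`exists_energy_le`), which gives coercivity. The cost is also a quadratic form
in the control, so its convexity defect is the cost of the difference (`cost_convexComb`), and
coercivity becomes uniform convexity. -/

namespace MFLQ

/-! ### Quadratic forms: completing the square, bounds, polarisation. -/

section LinearAlgebra

variable {n m : ℕ}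

theorem mulVec_dotProduct_comm_of_isSymm {M : Matrix (Fin n) (Fin n) ℝ} (hM : M.IsSymm)
    (x y : Fin n → ℝ) : (M *ᵥ x) ⬝ᵥ y = (M *ᵥ y) ⬝ᵥ x := by
  rw [dotProduct_comm, Matrix.dotProduct_mulVec, ← Matrix.mulVec_transpose, hM.eq]

theorem mulVec_dotProduct_mulVec {p q r : ℕ} (M : Matrix (Fin p) (Fin q) ℝ)
    (A : Matrix (Fin p) (Fin r) ℝ) (x : Fin q → ℝ) (y : Fin r → ℝ) :
    (M *ᵥ x) ⬝ᵥ (A *ᵥ y) = ((Aᵀ * M) *ᵥ x) ⬝ᵥ y := by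
  rw [Matrix.dotProduct_mulVec, ← Matrix.mulVec_transpose, Matrix.mulVec_mulVec]

theorem transpose_mulVec_dotProduct {p q : ℕ} (A : Matrix (Fin p) (Fin q) ℝ)
    (x : Fin p → ℝ) (y : Fin q → ℝ) : (Aᵀ *ᵥ x) ⬝ᵥ y = (A *ᵥ y) ⬝ᵥ x := by
  rw [Matrix.mulVec_transpose, ← Matrix.dotProduct_mulVec, dotProduct_comm]

theorem blockForm_eq (Q : Matrix (Fin n) (Fin n) ℝ) (S : Matrix (Fin m) (Fin n) ℝ)
    (R : Matrix (Fin m) (Fin m) ℝ) (x : Fin n → ℝ) (u : Fin m → ℝ) :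
    blockForm Q S R x u = (Q *ᵥ x) ⬝ᵥ x + 2 * ((S *ᵥ x) ⬝ᵥ u) + (R *ᵥ u) ⬝ᵥ u := by
  rw [blockForm, add_dotProduct, add_dotProduct, transpose_mulVec_dotProduct]
  ring

theorem blockForm_add (Q Q' : Matrix (Fin n) (Fin n) ℝ) (S S' : Matrix (Fin m) (Fin n) ℝ)
    (R R' : Matrix (Fin m) (Fin m) ℝ) (x : Fin n → ℝ) (u : Fin m → ℝ) :
    blockForm (Q + Q') (S + S') (R + R') x u = blockForm Q S R x u + blockForm Q' S' R' x u := by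
  simp only [blockForm_eq, Matrix.add_mulVec, add_dotProduct]
  ring

theorem quadForm_comp_eq_blockForm {P : Matrix (Fin n) (Fin n) ℝ} (hP : P.IsSymm)
    (A : Matrix (Fin n) (Fin n) ℝ) (B : Matrix (Fin n) (Fin m) ℝ)
    (x : Fin n → ℝ) (u : Fin m → ℝ) :
    (P *ᵥ (A *ᵥ x + B *ᵥ u)) ⬝ᵥ (A *ᵥ x + B *ᵥ u)
      = blockForm (Aᵀ * P * A) (Bᵀ * P * A) (Bᵀ * P * B) x u := by
  have h := mulVec_dotProduct_comm_of_isSymm hP (B *ᵥ u) (A *ᵥ x)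
  simp only [blockForm_eq, Matrix.mulVec_add, add_dotProduct, dotProduct_add, h]
  simp only [mulVec_dotProduct_mulVec, Matrix.mulVec_mulVec, Matrix.mul_assoc]
  ring

/-- Since `U * X = 1`, the cross term of the square is exactly `2⟨Hx, u⟩`, and its remaining part
`⟨Hᵀ X H x, x⟩` is what the Schur complement subtracts. -/
theorem blockForm_completeSquare (M : Matrix (Fin n) (Fin n) ℝ) (H : Matrix (Fin m) (Fin n) ℝ)
    {U X : Matrix (Fin m) (Fin m) ℝ} (hU : U.IsSymm) (hUX : U * X = 1)
    (x : Fin n → ℝ) (u : Fin m → ℝ) :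
    blockForm M H U x u = ((M - Hᵀ * X * H) *ᵥ x) ⬝ᵥ x
      + (U *ᵥ (u + (X * H) *ᵥ x)) ⬝ᵥ (u + (X * H) *ᵥ x) := by
  have h1 := mulVec_dotProduct_comm_of_isSymm hU u ((X * H) *ᵥ x)
  have h2 : U *ᵥ ((X * H) *ᵥ x) = H *ᵥ x := by
    rw [Matrix.mulVec_mulVec, ← Matrix.mul_assoc, hUX, Matrix.one_mul]
  have h3 : (H *ᵥ x) ⬝ᵥ ((X * H) *ᵥ x) = ((Hᵀ * X * H) *ᵥ x) ⬝ᵥ x := by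
    rw [dotProduct_comm, mulVec_dotProduct_mulVec, Matrix.mul_assoc]
  rw [blockForm_eq, Matrix.mulVec_add, add_dotProduct, dotProduct_add, dotProduct_add, h1, h2, h3,
    Matrix.sub_mulVec, sub_dotProduct]
  ring

/-- Cauchy–Schwarz in each row; the constant is the squared Frobenius norm. -/
theorem exists_mulVec_sq_le {p q : ℕ} (M : Matrix (Fin p) (Fin q) ℝ) :
    ∃ c : ℝ, 0 ≤ c ∧ ∀ x : Fin q → ℝ, (M *ᵥ x) ⬝ᵥ (M *ᵥ x) ≤ c * (x ⬝ᵥ x) := by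
  refine ⟨∑ i, ∑ j, M i j ^ 2, by positivity, fun x => ?_⟩
  rw [Finset.sum_mul]
  refine Finset.sum_le_sum fun i _ => ?_
  have h := Finset.sum_mul_sq_le_sq_mul_sq Finset.univ (M i) x
  simpa only [Matrix.mulVec, dotProduct, ← sq] using h

theorem dotProduct_self_nonneg' (x : Fin n → ℝ) : 0 ≤ x ⬝ᵥ x :=
  Finset.sum_nonneg fun i _ => mul_self_nonneg (x i)

theorem two_mul_dotProduct_le (x y : Fin n → ℝ) : 2 * (x ⬝ᵥ y) ≤ x ⬝ᵥ x + y ⬝ᵥ y := by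
  have h := dotProduct_self_nonneg' (x - y)
  simp only [sub_dotProduct, dotProduct_sub, dotProduct_comm y x] at h
  linarith

theorem exists_blockForm_le (Q : Matrix (Fin n) (Fin n) ℝ) (S : Matrix (Fin m) (Fin n) ℝ)
    (R : Matrix (Fin m) (Fin m) ℝ) :
    ∃ c : ℝ, 0 ≤ c ∧ ∀ x u, blockForm Q S R x u ≤ c * (x ⬝ᵥ x + u ⬝ᵥ u) := by
  obtain ⟨a, ha, hQ⟩ := exists_mulVec_sq_le Q
  obtain ⟨b, hb, hS⟩ := exists_mulVec_sq_le S
  obtain ⟨c, hc, hR⟩ := exists_mulVec_sq_le R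
  refine ⟨a + b + c + 2, by positivity, fun x u => ?_⟩
  rw [blockForm_eq]
  have h1 := two_mul_dotProduct_le (Q *ᵥ x) x
  have h2 := two_mul_dotProduct_le (S *ᵥ x) u
  have h3 := two_mul_dotProduct_le (R *ᵥ u) u
  have h4 := hQ x
  have h5 := hS x
  have h6 := hR u
  have hx := dotProduct_self_nonneg' x
  have hu := dotProduct_self_nonneg' u
  nlinarith [mul_nonneg ha hx, mul_nonneg hb hx, mul_nonneg hc hx, mul_nonneg ha hu,
    mul_nonneg hb hu, mul_nonneg hc hu]

theorem dotProduct_self_le_of_add (x y : Fin n → ℝ) :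
    x ⬝ᵥ x ≤ 2 * ((x + y) ⬝ᵥ (x + y)) + 2 * (y ⬝ᵥ y) := by
  -- The right side minus the left is exactly `|x + 2y|²`.
  have h := dotProduct_self_nonneg' (x + y + y)
  simp only [add_dotProduct, dotProduct_add, dotProduct_comm y x] at h ⊢
  linarith

/-- An identity for every real `t` and every `M`: neither symmetry nor a sign is needed, so
convexity reduces to the sign of the form on differences. -/
theorem quadForm_convexComb {M : Matrix (Fin n) (Fin n) ℝ} (t : ℝ) (x y : Fin n → ℝ) :
    (M *ᵥ (t • x + (1 - t) • y)) ⬝ᵥ (t • x + (1 - t) • y)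
      = t * ((M *ᵥ x) ⬝ᵥ x) + (1 - t) * ((M *ᵥ y) ⬝ᵥ y)
        - t * (1 - t) * ((M *ᵥ (x - y)) ⬝ᵥ (x - y)) := by
  simp only [Matrix.mulVec_add, Matrix.mulVec_smul, Matrix.mulVec_sub, add_dotProduct,
    dotProduct_add, smul_dotProduct, dotProduct_smul, sub_dotProduct, dotProduct_sub, smul_eq_mul]
  ring

theorem blockForm_convexComb (Q : Matrix (Fin n) (Fin n) ℝ) (S : Matrix (Fin m) (Fin n) ℝ)
    (R : Matrix (Fin m) (Fin m) ℝ) (t : ℝ) (x y : Fin n → ℝ) (u v : Fin m → ℝ) :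
    blockForm Q S R (t • x + (1 - t) • y) (t • u + (1 - t) • v)
      = t * blockForm Q S R x u + (1 - t) * blockForm Q S R y v
        - t * (1 - t) * blockForm Q S R (x - y) (u - v) := by
  simp only [blockForm_eq, quadForm_convexComb]
  simp only [Matrix.mulVec_add, Matrix.mulVec_smul, Matrix.mulVec_sub, add_dotProduct,
    dotProduct_add, smul_dotProduct, dotProduct_smul, sub_dotProduct, dotProduct_sub, smul_eq_mul]
  ring

/-- Polarisation: a symmetric bilinear form is determined by its diagonal. -/
theorem eq_of_quadForm_eq {M M' : Matrix (Fin n) (Fin n) ℝ} (hM : M.IsSymm) (hM' : M'.IsSymm)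
    (h : ∀ x, (M *ᵥ x) ⬝ᵥ x = (M' *ᵥ x) ⬝ᵥ x) : M = M' := by
  have key : ∀ x y, (M *ᵥ x) ⬝ᵥ y = (M' *ᵥ x) ⬝ᵥ y := fun x y => by
    have hxy := h (x + y)
    simp only [Matrix.mulVec_add, add_dotProduct, dotProduct_add, h x, h y,
      mulVec_dotProduct_comm_of_isSymm hM y x, mulVec_dotProduct_comm_of_isSymm hM' y x] at hxy
    linarith
  ext i j
  simpa using key (Pi.single j 1) (Pi.single i 1)

/-- `U` is the positive definite `α • 1` plus a positive semidefinite matrix. -/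
theorem isUnit_det_of_posSemidef_sub {U : Matrix (Fin m) (Fin m) ℝ} {α : ℝ} (hα : 0 < α)
    (h : (U - α • 1).PosSemidef) : IsUnit U.det := by
  have h1 : (α • (1 : Matrix (Fin m) (Fin m) ℝ)).PosDef := Matrix.PosDef.one.smul hα
  have h2 := h1.add_posSemidef h
  rw [add_sub_cancel] at h2
  exact (Matrix.isUnit_iff_isUnit_det _).1 h2.isUnit

theorem isMoorePenrose_inv {U : Matrix (Fin m) (Fin m) ℝ} (h : IsUnit U.det) :
    IsMoorePenrose U U⁻¹ where
  mul_mul_left := by rw [Matrix.mul_nonsing_inv _ h, Matrix.one_mul]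
  mul_mul_right := by rw [Matrix.nonsing_inv_mul _ h, Matrix.one_mul]
  symm_left := by rw [Matrix.mul_nonsing_inv _ h]; exact Matrix.isSymm_one
  symm_right := by rw [Matrix.nonsing_inv_mul _ h]; exact Matrix.isSymm_one

theorem mul_dotProduct_self_le_of_posSemidef_sub {U : Matrix (Fin m) (Fin m) ℝ} {α : ℝ}
    (h : (U - α • 1).PosSemidef) (x : Fin m → ℝ) : α * (x ⬝ᵥ x) ≤ (U *ᵥ x) ⬝ᵥ x := by
  have h1 := h.dotProduct_mulVec_nonneg x
  simp only [star_trivial, Matrix.sub_mulVec, Matrix.smul_mulVec, Matrix.one_mulVec,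
    dotProduct_sub, dotProduct_smul, smul_eq_mul] at h1
  rw [dotProduct_comm (U *ᵥ x)]
  linarith

end LinearAlgebra

/-! ### Integrals of the noise against functions of the past. -/

section Noise

variable {Ω : Type*} {m mΩ : MeasurableSpace Ω} {μ : Measure Ω} [IsProbabilityMeasure μ]

/-- The measure with density `w²` agrees with `μ` on the σ-algebra `m`, so an `m`-measurable
function has the same integrability and integral under both. Integrability of `w² f` is thus a
conclusion, though `f` is merely integrable. -/
theorem integrable_sq_mul_of_condExp_sq_eq_one (hm : m ≤ mΩ) {w f : Ω → ℝ} (hw : MemLp w 2 μ)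
    (hw1 : μ[fun a => w a ^ 2|m] =ᵐ[μ] fun _ => 1) (hf : StronglyMeasurable[m] f)
    (hfi : Integrable f μ) :
    Integrable (fun a => w a ^ 2 * f a) μ ∧ ∫ a, w a ^ 2 * f a ∂μ = ∫ a, f a ∂μ := by
  have hw2 : Integrable (fun a => w a ^ 2) μ := hw.integrable_sq
  set ν := μ.withDensity fun a => ENNReal.ofReal (w a ^ 2) with hν
  have hmeas : AEMeasurable (fun a => ENNReal.ofReal (w a ^ 2)) μ :=
    hw2.aemeasurable.ennreal_ofReal
  have htrim : ν.trim hm = μ.trim hm := by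
    refine @Measure.ext _ m _ _ fun s hs => ?_
    rw [trim_measurableSet_eq hm hs, trim_measurableSet_eq hm hs, hν,
      withDensity_apply _ (hm s hs), ← ofReal_integral_eq_lintegral_ofReal hw2.integrableOn
        (ae_of_all _ fun a => sq_nonneg (w a)), ← setIntegral_condExp hm hw2 hs,
      setIntegral_congr_ae (g := fun _ => (1 : ℝ)) (hm s hs) (hw1.mono fun a ha _ => ha)]
    simp
  have hfν : Integrable f ν := by
    refine integrable_of_integrable_trim hm ?_
    rw [htrim]
    exact hfi.trim hm hf
  have hfin : ∀ᵐ a ∂μ, ENNReal.ofReal (w a ^ 2) < ⊤ := ae_of_all _ fun a => ENNReal.ofReal_lt_top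
  constructor
  · rw [hν, integrable_withDensity_iff_integrable_smul₀' hmeas hfin] at hfν
    refine hfν.congr (ae_of_all _ fun a => ?_)
    simp [ENNReal.toReal_ofReal (sq_nonneg (w a))]
  · have h := integral_withDensity_eq_integral_toReal_smul₀ hmeas hfin f
    rw [← hν, integral_trim hm hf, htrim, ← integral_trim hm hf] at h
    rw [h]
    refine integral_congr_ae (ae_of_all _ fun a => ?_)
    simp [ENNReal.toReal_ofReal (sq_nonneg (w a))]

theorem integrable_mul_of_condExp_eq_zero (hm : m ≤ mΩ) {w f : Ω → ℝ} (hw : MemLp w 2 μ)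
    (hw0 : μ[w|m] =ᵐ[μ] fun _ => 0)
    (hw1 : μ[fun a => w a ^ 2|m] =ᵐ[μ] fun _ => 1) (hf : StronglyMeasurable[m] f)
    (hfi : Integrable f μ) :
    Integrable (fun a => w a * f a) μ ∧ ∫ a, w a * f a ∂μ = 0 := by
  have h2 := (integrable_sq_mul_of_condExp_sq_eq_one hm hw hw1 hf hfi).1
  have hi : Integrable (fun a => w a * f a) μ := by
    -- Domination by `|w f| ≤ |f| + w² |f|`, from `|w| ≤ 1 + w²`.
    refine (hfi.norm.add h2.norm).mono' (hw.1.mul hfi.1) (ae_of_all _ fun a => ?_)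
    simp only [Pi.add_apply, norm_mul, norm_pow, Real.norm_eq_abs]
    nlinarith [abs_nonneg (f a), abs_nonneg (w a),
      mul_nonneg (abs_nonneg (f a)) (sq_nonneg (|w a| - 1)),
      mul_nonneg (abs_nonneg (f a)) (sq_nonneg (|w a| + 1))]
  refine ⟨hi, ?_⟩
  have hi' : Integrable (f * w) μ := hi.congr (ae_of_all _ fun a => mul_comm _ _)
  have h := condExp_mul_of_stronglyMeasurable_left hf hi' (hw.integrable one_le_two)
  calc ∫ a, w a * f a ∂μ = ∫ a, (f * w) a ∂μ :=
        integral_congr_ae (ae_of_all _ fun a => mul_comm _ _)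
    _ = ∫ a, (μ[f * w|m]) a ∂μ := (integral_condExp hm).symm
    _ = ∫ _, (0 : ℝ) ∂μ := integral_congr_ae (by
        filter_upwards [h, hw0] with a h1 h2
        simp [h1, h2])
    _ = 0 := by simp

end Noise

/-! ### Square integrability and linear maps under the integral. -/

section Moments

variable {Ω : Type*} {mΩ : MeasurableSpace Ω} {μ : Measure Ω} {n m p q : ℕ}

theorem memLp_mulVec (M : Matrix (Fin p) (Fin q) ℝ) {X : Ω → Fin q → ℝ} (hX : MemLp X 2 μ) :
    MemLp (fun a => M *ᵥ X a) 2 μ :=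
  M.mulVecLin.toContinuousLinearMap.comp_memLp' hX

theorem integral_mulVec (M : Matrix (Fin p) (Fin q) ℝ) {X : Ω → Fin q → ℝ}
    (hX : Integrable X μ) : ∫ a, M *ᵥ X a ∂μ = M *ᵥ ∫ a, X a ∂μ :=
  M.mulVecLin.toContinuousLinearMap.integral_comp_comm hX

theorem memLp_apply {X : Ω → Fin q → ℝ} (hX : MemLp X 2 μ) (i : Fin q) :
    MemLp (fun a => X a i) 2 μ :=
  (ContinuousLinearMap.proj (R := ℝ) (φ := fun _ : Fin q => ℝ) i).comp_memLp' hX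

theorem memLp_of_apply {X : Ω → Fin q → ℝ} (hX : ∀ i, MemLp (fun a => X a i) 2 μ) :
    MemLp X 2 μ :=
  MemLp.of_eval hX

theorem integral_dotProduct_const {X : Ω → Fin q → ℝ} (hX : Integrable X μ) (y : Fin q → ℝ) :
    ∫ a, X a ⬝ᵥ y ∂μ = (∫ a, X a ∂μ) ⬝ᵥ y := by
  exact ((dotProductBilin ℝ ℝ).flip y :
    (Fin q → ℝ) →ₗ[ℝ] ℝ).toContinuousLinearMap.integral_comp_comm hX

theorem integrable_dotProduct {X Y : Ω → Fin q → ℝ} (hX : MemLp X 2 μ) (hY : MemLp Y 2 μ) :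
    Integrable (fun a => X a ⬝ᵥ Y a) μ :=
  integrable_finsetSum _ fun i _ => (memLp_apply hX i).integrable_mul (memLp_apply hY i)

theorem integrable_blockForm (Q : Matrix (Fin n) (Fin n) ℝ) (S : Matrix (Fin m) (Fin n) ℝ)
    (R : Matrix (Fin m) (Fin m) ℝ) {X : Ω → Fin n → ℝ} {U : Ω → Fin m → ℝ} (hX : MemLp X 2 μ)
    (hU : MemLp U 2 μ) : Integrable (fun a => blockForm Q S R (X a) (U a)) μ := by
  simp only [blockForm_eq]
  exact ((integrable_dotProduct (memLp_mulVec Q hX) hX).add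
    ((integrable_dotProduct (memLp_mulVec S hX) hU).const_mul 2)).add
    (integrable_dotProduct (memLp_mulVec R hU) hU)

end Moments

/-! ### Splitting second moments into centred and mean parts. -/

section Moments

variable {Ω : Type*} {mΩ : MeasurableSpace Ω} {μ : Measure Ω} [IsProbabilityMeasure μ] {n m : ℕ}

theorem integral_add_add {Ω E : Type*} {mΩ : MeasurableSpace Ω} {μ : Measure Ω}
    [NormedAddCommGroup E] [NormedSpace ℝ E] {f g h : Ω → E} (hf : Integrable f μ)
    (hg : Integrable g μ) (hh : Integrable h μ) :
    ∫ a, (f a + g a + h a) ∂μ = ∫ a, f a ∂μ + ∫ a, g a ∂μ + ∫ a, h a ∂μ := by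
  rw [integral_add (f := fun a => f a + g a) (hf.add hg) hh, integral_add hf hg]

theorem integral_center {X : Ω → Fin n → ℝ} (hX : MemLp X 2 μ) :
    ∫ a, (X a - ∫ b, X b ∂μ) ∂μ = 0 := by
  rw [integral_sub (hX.integrable one_le_two) (integrable_const _)]
  simp

theorem memLp_center {X : Ω → Fin n → ℝ} (hX : MemLp X 2 μ) :
    MemLp (fun a => X a - ∫ b, X b ∂μ) 2 μ :=
  hX.sub (memLp_const _)

/-- The mixed terms vanish because a centred variable has mean zero. -/
theorem integral_bilin_center {p q : ℕ} (M : Matrix (Fin p) (Fin q) ℝ) {X : Ω → Fin q → ℝ}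
    {Y : Ω → Fin p → ℝ} (hX : MemLp X 2 μ) (hY : MemLp Y 2 μ) :
    ∫ a, (M *ᵥ X a) ⬝ᵥ Y a ∂μ
      = ∫ a, (M *ᵥ (X a - ∫ b, X b ∂μ)) ⬝ᵥ (Y a - ∫ b, Y b ∂μ) ∂μ
        + (M *ᵥ ∫ b, X b ∂μ) ⬝ᵥ ∫ b, Y b ∂μ := by
  set x := ∫ b, X b ∂μ
  set y := ∫ b, Y b ∂μ
  have hXc := memLp_mulVec M (memLp_center hX)
  have e : ∀ a, (M *ᵥ X a) ⬝ᵥ Y a = (M *ᵥ (X a - x)) ⬝ᵥ (Y a - y) + (M *ᵥ (X a - x)) ⬝ᵥ y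
      + Y a ⬝ᵥ (M *ᵥ x) := fun a => by
    rw [dotProduct_comm (Y a), Matrix.mulVec_sub, sub_dotProduct, dotProduct_sub, dotProduct_sub,
      sub_dotProduct]
    ring
  have i1 := integrable_dotProduct hXc (memLp_center hY)
  have i2 := integrable_dotProduct hXc (memLp_const y)
  have i3 := integrable_dotProduct hY (memLp_const (M *ᵥ x))
  simp only [e]
  rw [integral_add_add i1 i2 i3,
    integral_dotProduct_const (hXc.integrable one_le_two),
    integral_dotProduct_const (hY.integrable one_le_two),
    integral_mulVec M ((memLp_center hX).integrable one_le_two), integral_center hX,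
    dotProduct_comm (∫ a, Y a ∂μ)]
  simp [x, y]

theorem integral_blockForm_center (Q : Matrix (Fin n) (Fin n) ℝ) (S : Matrix (Fin m) (Fin n) ℝ)
    (R : Matrix (Fin m) (Fin m) ℝ) {X : Ω → Fin n → ℝ} {U : Ω → Fin m → ℝ} (hX : MemLp X 2 μ)
    (hU : MemLp U 2 μ) :
    ∫ a, blockForm Q S R (X a) (U a) ∂μ
      = ∫ a, blockForm Q S R (X a - ∫ b, X b ∂μ) (U a - ∫ b, U b ∂μ) ∂μ
        + blockForm Q S R (∫ b, X b ∂μ) (∫ b, U b ∂μ) := by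
  have key : ∀ {X : Ω → Fin n → ℝ} {U : Ω → Fin m → ℝ}, MemLp X 2 μ → MemLp U 2 μ →
      ∫ a, blockForm Q S R (X a) (U a) ∂μ = ∫ a, (Q *ᵥ X a) ⬝ᵥ X a ∂μ
        + 2 * ∫ a, (S *ᵥ X a) ⬝ᵥ U a ∂μ + ∫ a, (R *ᵥ U a) ⬝ᵥ U a ∂μ := by
    intro X U hX hU
    have i1 := integrable_dotProduct (memLp_mulVec Q hX) hX
    have i2 := (integrable_dotProduct (memLp_mulVec S hX) hU).const_mul 2
    have i3 := integrable_dotProduct (memLp_mulVec R hU) hU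
    simp only [blockForm_eq]
    rw [integral_add_add i1 i2 i3, integral_const_mul]
  rw [key hX hU, key (memLp_center hX) (memLp_center hU), blockForm_eq,
    integral_bilin_center Q hX hX, integral_bilin_center S hX hU, integral_bilin_center R hU hU]
  ring

/-- `𝔼⟨P (X - 𝔼X), X - 𝔼X⟩ + ⟨Π 𝔼X, 𝔼X⟩`. -/
noncomputable def meanForm (μ : Measure Ω) (P Pi : Matrix (Fin n) (Fin n) ℝ)
    (X : Ω → Fin n → ℝ) : ℝ :=
  (∫ a, (P *ᵥ (X a - ∫ b, X b ∂μ)) ⬝ᵥ (X a - ∫ b, X b ∂μ) ∂μ)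
    + (Pi *ᵥ (∫ b, X b ∂μ)) ⬝ᵥ (∫ b, X b ∂μ)

theorem meanForm_one {X : Ω → Fin n → ℝ} (hX : MemLp X 2 μ) :
    meanForm μ 1 1 X = ∫ a, X a ⬝ᵥ X a ∂μ := by
  have h := integral_bilin_center (1 : Matrix (Fin n) (Fin n) ℝ) hX hX
  rw [meanForm, ← h]
  simp only [Matrix.one_mulVec]

theorem integral_quadForm_add_eq_meanForm (G Gb : Matrix (Fin n) (Fin n) ℝ) {X : Ω → Fin n → ℝ}
    (hX : MemLp X 2 μ) :
    ∫ a, (G *ᵥ X a) ⬝ᵥ X a ∂μ + (Gb *ᵥ ∫ b, X b ∂μ) ⬝ᵥ (∫ b, X b ∂μ)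
      = meanForm μ G (G + Gb) X := by
  rw [meanForm, integral_bilin_center G hX hX, Matrix.add_mulVec, add_dotProduct]
  ring

/-- A product of two square integrable functions need not be square integrable; here the constant
conditional variance gives `𝔼 w² Zᵢ² = 𝔼 Zᵢ²`. -/
theorem memLp_noise_smul {m₀ : MeasurableSpace Ω} (hm : m₀ ≤ mΩ) {w : Ω → ℝ} (hw : MemLp w 2 μ)
    (hw1 : μ[fun a => w a ^ 2|m₀] =ᵐ[μ] fun _ => 1) {Z : Ω → Fin n → ℝ} (hZm : Measurable[m₀] Z)
    (hZ : MemLp Z 2 μ) : MemLp (fun a => w a • Z a) 2 μ := by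
  refine memLp_of_apply fun i => ?_
  have hi := memLp_apply hZ i
  have hm' : Measurable[m₀] fun a => Z a i := (measurable_pi_apply i).comp hZm
  have hae : AEStronglyMeasurable[mΩ] (fun a => (w a • Z a) i) μ := hw.1.smul hi.1
  rw [memLp_two_iff_integrable_sq hae]
  have h := (integrable_sq_mul_of_condExp_sq_eq_one hm hw hw1 (hm'.pow_const 2).stronglyMeasurable
    hi.integrable_sq).1
  exact h.congr (ae_of_all _ fun a => by simp [mul_pow])

theorem measurable_dotProduct' {m₀ : MeasurableSpace Ω} {X Y : Ω → Fin n → ℝ}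
    (hX : Measurable[m₀] X) (hY : Measurable[m₀] Y) : Measurable[m₀] fun a => X a ⬝ᵥ Y a :=
  Finset.measurable_fun_sum _ fun i _ =>
    ((measurable_pi_apply i).comp hX).mul ((measurable_pi_apply i).comp hY)

theorem measurable_mulVec {m₀ : MeasurableSpace Ω} (M : Matrix (Fin m) (Fin n) ℝ)
    {X : Ω → Fin n → ℝ} (hX : Measurable[m₀] X) : Measurable[m₀] fun a => M *ᵥ X a :=
  M.mulVecLin.toContinuousLinearMap.continuous.measurable.comp hX

theorem integral_noise_smul {m₀ : MeasurableSpace Ω} (hm : m₀ ≤ mΩ) {w : Ω → ℝ}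
    (hw : MemLp w 2 μ) (hw0 : μ[w|m₀] =ᵐ[μ] fun _ => 0)
    (hw1 : μ[fun a => w a ^ 2|m₀] =ᵐ[μ] fun _ => 1) {Z : Ω → Fin n → ℝ} (hZm : Measurable[m₀] Z)
    (hZ : MemLp Z 2 μ) : ∫ a, w a • Z a ∂μ = 0 := by
  ext i
  have hwZ := memLp_noise_smul hm hw hw1 hZm hZ
  have hi : ∀ i, Integrable (fun a => (w a • Z a) i) μ := fun i =>
    (memLp_apply hwZ i).integrable one_le_two
  rw [eval_integral hi]
  have hm' : Measurable[m₀] fun a => Z a i := (measurable_pi_apply i).comp hZm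
  exact (integrable_mul_of_condExp_eq_zero hm hw hw0 hw1 hm'.stronglyMeasurable
    ((memLp_apply hZ i).integrable one_le_two)).2

/-- The part linear in `w` integrates to zero by the conditional mean; in the quadratic part `w²`
may be replaced by `1`. -/
theorem integral_quadForm_add_noise_smul {m₀ : MeasurableSpace Ω} (hm : m₀ ≤ mΩ) {w : Ω → ℝ}
    (hw : MemLp w 2 μ) (hw0 : μ[w|m₀] =ᵐ[μ] fun _ => 0)
    (hw1 : μ[fun a => w a ^ 2|m₀] =ᵐ[μ] fun _ => 1) (P : Matrix (Fin n) (Fin n) ℝ)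
    {Y Z : Ω → Fin n → ℝ} (hYm : Measurable[m₀] Y)
    (hY : MemLp Y 2 μ) (hZm : Measurable[m₀] Z) (hZ : MemLp Z 2 μ) :
    ∫ a, (P *ᵥ (Y a + w a • Z a)) ⬝ᵥ (Y a + w a • Z a) ∂μ
      = ∫ a, (P *ᵥ Y a) ⬝ᵥ Y a ∂μ + ∫ a, (P *ᵥ Z a) ⬝ᵥ Z a ∂μ := by
  have e : ∀ a, (P *ᵥ (Y a + w a • Z a)) ⬝ᵥ (Y a + w a • Z a) = (P *ᵥ Y a) ⬝ᵥ Y a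
      + w a * ((P *ᵥ Y a) ⬝ᵥ Z a + (P *ᵥ Z a) ⬝ᵥ Y a) + w a ^ 2 * ((P *ᵥ Z a) ⬝ᵥ Z a) := by
    intro a
    simp only [Matrix.mulVec_add, Matrix.mulVec_smul, add_dotProduct,
      dotProduct_add, smul_dotProduct, dotProduct_smul, smul_eq_mul]
    ring
  have i1 := integrable_dotProduct (memLp_mulVec P hY) hY
  obtain ⟨i2, h2⟩ := integrable_mul_of_condExp_eq_zero hm hw hw0 hw1
    ((measurable_dotProduct' (measurable_mulVec P hYm) hZm).add
      (measurable_dotProduct' (measurable_mulVec P hZm) hYm)).stronglyMeasurable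
    ((integrable_dotProduct (memLp_mulVec P hY) hZ).add
      (integrable_dotProduct (memLp_mulVec P hZ) hY))
  obtain ⟨i3, h3⟩ := integrable_sq_mul_of_condExp_sq_eq_one hm hw hw1
    (measurable_dotProduct' (measurable_mulVec P hZm) hZm).stronglyMeasurable
    (integrable_dotProduct (memLp_mulVec P hZ) hZ)
  simp only [Pi.add_apply] at i2 h2
  simp only [e]
  rw [integral_add_add i1 i2 i3, h2, h3, add_zero]

end Moments

/-! ### One step of the dynamics and its effect on second moments. -/

section Step

variable {Ω : Type*} {mΩ : MeasurableSpace Ω} {μ : Measure Ω} {n m N : ℕ}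

/-- One step of the state equation. -/
noncomputable def step (d : Data n m N) (μ : Measure Ω) (ω : ℕ → Ω → ℝ) (k : ℕ)
    (x : Ω → Fin n → ℝ) (u : Ω → Fin m → ℝ) : Ω → Fin n → ℝ := fun a =>
  (d.A k *ᵥ x a + d.Ab k *ᵥ (∫ b, x b ∂μ) + d.B k *ᵥ u a + d.Bb k *ᵥ (∫ b, u b ∂μ))
    + ω k a • (d.C k *ᵥ x a + d.Cb k *ᵥ (∫ b, x b ∂μ)
        + d.D k *ᵥ u a + d.Db k *ᵥ (∫ b, u b ∂μ))

theorem state_of_le (d : Data n m N) (ω : ℕ → Ω → ℝ) {l : ℕ} (ξ : Ω → Fin n → ℝ)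
    (u : ℕ → Ω → Fin m → ℝ) {k : ℕ} (hk : k ≤ l) : state d μ ω l ξ u k = ξ := by
  cases k with
  | zero => rfl
  | succ k => rw [state, if_pos (Nat.lt_of_succ_le hk)]

theorem state_succ (d : Data n m N) (ω : ℕ → Ω → ℝ) {l : ℕ} (ξ : Ω → Fin n → ℝ)
    (u : ℕ → Ω → Fin m → ℝ) {k : ℕ} (hk : l ≤ k) :
    state d μ ω l ξ u (k + 1) = step d μ ω k (state d μ ω l ξ u k) (u k) := by
  rw [state, if_neg (not_lt.2 hk)]
  rfl

theorem measurable_step {ℱ : Filtration ℕ mΩ} {ω : ℕ → Ω → ℝ} (hω : IsNoise μ ℱ ω N)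
    (d : Data n m N) {k : ℕ} (hk : k < N) {x : Ω → Fin n → ℝ} {u : Ω → Fin m → ℝ}
    (hxm : Measurable[ℱ k] x) (hum : Measurable[ℱ k] u) :
    Measurable[ℱ (k + 1)] (step d μ ω k x u) := by
  have hx := hxm.mono (ℱ.mono k.le_succ) le_rfl
  have hu := hum.mono (ℱ.mono k.le_succ) le_rfl
  exact ((((measurable_mulVec _ hx).add_const _).add (measurable_mulVec _ hu)).add_const _).add
    ((hω.adapted k hk).smul
      ((((measurable_mulVec _ hx).add_const _).add (measurable_mulVec _ hu)).add_const _))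

variable [IsProbabilityMeasure μ]

theorem memLp_step {ℱ : Filtration ℕ mΩ} {ω : ℕ → Ω → ℝ} (hω : IsNoise μ ℱ ω N)
    (d : Data n m N) {k : ℕ} (hk : k < N) {x : Ω → Fin n → ℝ} {u : Ω → Fin m → ℝ}
    (hxm : Measurable[ℱ k] x) (hx : MemLp x 2 μ) (hum : Measurable[ℱ k] u) (hu : MemLp u 2 μ) :
    MemLp (step d μ ω k x u) 2 μ := by
  have h1 : ∀ (A Ab : Matrix (Fin n) (Fin n) ℝ) (B Bb : Matrix (Fin n) (Fin m) ℝ), MemLp (fun a =>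
      A *ᵥ x a + Ab *ᵥ (∫ b, x b ∂μ) + B *ᵥ u a + Bb *ᵥ (∫ b, u b ∂μ)) 2 μ := fun A Ab B Bb =>
    (((memLp_mulVec _ hx).add (memLp_const _)).add (memLp_mulVec _ hu)).add (memLp_const _)
  exact (h1 _ _ _ _).add (memLp_noise_smul (ℱ.le k) (hω.memLp k hk) (hω.condExp_sq_eq_one k hk)
    ((((measurable_mulVec _ hxm).add_const _).add (measurable_mulVec _ hum)).add_const _)
    (h1 _ _ _ _))

/-- The mean of the new state is driven by `A + Ab` and `B + Bb` alone. The noise coefficient keeps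
its own mean, but multiplied by the noise it belongs to the fluctuation. This is why the mean block
weighs `C + Cb` and `D + Db` with `P` instead of `Pi`. -/
theorem meanForm_step {ℱ : Filtration ℕ mΩ} {ω : ℕ → Ω → ℝ} (hω : IsNoise μ ℱ ω N)
    (d : Data n m N) {k : ℕ} (hk : k < N) {P Pi : Matrix (Fin n) (Fin n) ℝ}
    (hP : P.IsSymm) (hPi : Pi.IsSymm) {x : Ω → Fin n → ℝ} {u : Ω → Fin m → ℝ}
    (hxm : Measurable[ℱ k] x) (hx : MemLp x 2 μ) (hum : Measurable[ℱ k] u) (hu : MemLp u 2 μ) :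
    meanForm μ P Pi (step d μ ω k x u)
      = ∫ a, blockForm ((d.A k)ᵀ * P * d.A k + (d.C k)ᵀ * P * d.C k)
          ((d.B k)ᵀ * P * d.A k + (d.D k)ᵀ * P * d.C k)
          ((d.B k)ᵀ * P * d.B k + (d.D k)ᵀ * P * d.D k)
          (x a - ∫ b, x b ∂μ) (u a - ∫ b, u b ∂μ) ∂μ
        + blockForm
          ((d.A k + d.Ab k)ᵀ * Pi * (d.A k + d.Ab k) + (d.C k + d.Cb k)ᵀ * P * (d.C k + d.Cb k))
          ((d.B k + d.Bb k)ᵀ * Pi * (d.A k + d.Ab k) + (d.D k + d.Db k)ᵀ * P * (d.C k + d.Cb k))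
          ((d.B k + d.Bb k)ᵀ * Pi * (d.B k + d.Bb k) + (d.D k + d.Db k)ᵀ * P * (d.D k + d.Db k))
          (∫ b, x b ∂μ) (∫ b, u b ∂μ) := by
  have hw := hω.memLp k hk
  have hw0 := hω.condExp_eq_zero k hk
  have hw1 := hω.condExp_sq_eq_one k hk
  set xb := ∫ b, x b ∂μ with hxb
  set ub := ∫ b, u b ∂μ with hub
  have hcx := memLp_center hx
  have hcu := memLp_center hu
  have hcxm : Measurable[ℱ k] fun a => x a - xb := hxm.sub_const xb
  have hcum : Measurable[ℱ k] fun a => u a - ub := hum.sub_const ub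
  have lin : ∀ (A : Matrix (Fin n) (Fin n) ℝ) (B : Matrix (Fin n) (Fin m) ℝ),
      MemLp (fun a => A *ᵥ (x a - xb) + B *ᵥ (u a - ub)) 2 μ := fun A B =>
    (memLp_mulVec A hcx).add (memLp_mulVec B hcu)
  have linm : ∀ (A : Matrix (Fin n) (Fin n) ℝ) (B : Matrix (Fin n) (Fin m) ℝ),
      Measurable[ℱ k] (fun a => A *ᵥ (x a - xb) + B *ᵥ (u a - ub)) := fun A B =>
    (measurable_mulVec A hcxm).add (measurable_mulVec B hcum)
  have lin0 : ∀ (A : Matrix (Fin n) (Fin n) ℝ) (B : Matrix (Fin n) (Fin m) ℝ),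
      ∫ a, (A *ᵥ (x a - xb) + B *ᵥ (u a - ub)) ∂μ = 0 := fun A B => by
    rw [integral_add ((memLp_mulVec A hcx).integrable one_le_two)
      ((memLp_mulVec B hcu).integrable one_le_two), integral_mulVec A (hcx.integrable one_le_two),
      integral_mulVec B (hcu.integrable one_le_two), integral_center hx, integral_center hu]
    simp
  set Y : Ω → Fin n → ℝ := fun a => d.A k *ᵥ (x a - xb) + d.B k *ᵥ (u a - ub) with hY
  set y := (d.A k + d.Ab k) *ᵥ xb + (d.B k + d.Bb k) *ᵥ ub with hy
  set z := (d.C k + d.Cb k) *ᵥ xb + (d.D k + d.Db k) *ᵥ ub with hz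
  set W : Ω → Fin n → ℝ := fun a => d.C k *ᵥ (x a - xb) + d.D k *ᵥ (u a - ub) with hW
  set Z : Ω → Fin n → ℝ := fun a => W a + z with hZ
  have hZL : MemLp Z 2 μ := (lin _ _).add (memLp_const z)
  have hZm : Measurable[ℱ k] Z := (linm _ _).add_const z
  -- `Y` is the centred drift, `y` its mean, and `Z = W + z` the noise coefficient, with `W`
  -- centred.
  have hstep : step d μ ω k x u = fun a => (Y a + ω k a • Z a) + y := by
    funext a
    simp only [step, hY, hZ, hW, hy, hz, Matrix.add_mulVec, Matrix.mulVec_sub, ← hxb, ← hub]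
    have e1 : ∀ p q r s t v : Fin n → ℝ, p - q + (r - s) + (q + t + (s + v)) = p + t + r + v := by
      intros; abel
    rw [e1, add_right_comm _ (ω k a • _), add_comm]
    have e2 : ∀ p q r s t v : Fin n → ℝ, p + t + r + v = p - q + (r - s) + (q + t + (s + v)) := by
      intros; abel
    rw [add_comm, ← e2]
  have hmean : ∫ a, step d μ ω k x u a ∂μ = y := by
    rw [hstep, integral_add_add ((lin _ _).integrable one_le_two)
      ((memLp_noise_smul (ℱ.le k) hw hw1 hZm hZL).integrable one_le_two) (integrable_const _), lin0,
      integral_noise_smul (ℱ.le k) hw hw0 hw1 hZm hZL]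
    simp
  have hZq : ∫ a, (P *ᵥ Z a) ⬝ᵥ Z a ∂μ = ∫ a, (P *ᵥ W a) ⬝ᵥ W a ∂μ + (P *ᵥ z) ⬝ᵥ z := by
    have hzm : ∫ a, Z a ∂μ = z := by
      rw [hZ, integral_add ((lin _ _).integrable one_le_two) (integrable_const _), lin0]
      simp
    rw [integral_bilin_center P hZL hZL, hzm]
    simp only [hZ, add_sub_cancel_right]
  rw [meanForm, hmean]
  simp only [hstep, add_sub_cancel_right]
  rw [integral_quadForm_add_noise_smul (ℱ.le k) hw hw0 hw1 P (linm _ _) (lin _ _) hZm hZL, hZq]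
  simp only [blockForm_add, hW, hy, hz]
  rw [integral_add (integrable_blockForm _ _ _ hcx hcu) (integrable_blockForm _ _ _ hcx hcu)]
  simp only [quadForm_comp_eq_blockForm hP, quadForm_comp_eq_blockForm hPi]
  ring

end Step

/-! ### Completing the square, the cost identity and the optimal feedback. -/

section Riccati

variable {Ω : Type*} {mΩ : MeasurableSpace Ω} {μ : Measure Ω} {n m N : ℕ}

/-- The right-hand side of the Riccati equation for `P`, for invertible `Υ_k`. -/
noncomputable def riccatiP (d : Data n m N) (P : ℕ → Matrix (Fin n) (Fin n) ℝ) (k : ℕ) :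
    Matrix (Fin n) (Fin n) ℝ :=
  d.Q k + (d.A k)ᵀ * P (k + 1) * d.A k + (d.C k)ᵀ * P (k + 1) * d.C k
    - (crossTerm d P k)ᵀ * (Upsilon d P k)⁻¹ * crossTerm d P k

/-- The right-hand side of the Riccati equation for `Π`, for invertible `Ῡ_k`. -/
noncomputable def riccatiPi (d : Data n m N) (P Pi : ℕ → Matrix (Fin n) (Fin n) ℝ) (k : ℕ) :
    Matrix (Fin n) (Fin n) ℝ :=
  d.Q k + d.Qb k + (d.A k + d.Ab k)ᵀ * Pi (k + 1) * (d.A k + d.Ab k)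
    + (d.C k + d.Cb k)ᵀ * P (k + 1) * (d.C k + d.Cb k)
    - (crossTermBar d P Pi k)ᵀ * (UpsilonBar d P Pi k)⁻¹ * crossTermBar d P Pi k

/-- The deviation `u - 𝔼u + Υ⁻¹ H (x - 𝔼x)` of a control from the optimal feedback. -/
noncomputable def deviation (d : Data n m N) (μ : Measure Ω) (P : ℕ → Matrix (Fin n) (Fin n) ℝ)
    (k : ℕ) (x : Ω → Fin n → ℝ) (u : Ω → Fin m → ℝ) : Ω → Fin m → ℝ := fun a =>
  (u a - ∫ b, u b ∂μ) + ((Upsilon d P k)⁻¹ * crossTerm d P k) *ᵥ (x a - ∫ b, x b ∂μ)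

/-- The deviation `𝔼u + Ῡ⁻¹ H̄ 𝔼x` of the mean of a control from the optimal feedback. -/
noncomputable def meanDeviation (d : Data n m N) (μ : Measure Ω)
    (P Pi : ℕ → Matrix (Fin n) (Fin n) ℝ)
    (k : ℕ) (x : Ω → Fin n → ℝ) (u : Ω → Fin m → ℝ) : Fin m → ℝ :=
  (∫ b, u b ∂μ) + ((UpsilonBar d P Pi k)⁻¹ * crossTermBar d P Pi k) *ᵥ (∫ b, x b ∂μ)

/-- The excess cost of a control over the optimal feedback in one step. -/
noncomputable def excess (d : Data n m N) (μ : Measure Ω)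
    (P Pi : ℕ → Matrix (Fin n) (Fin n) ℝ)
    (k : ℕ) (x : Ω → Fin n → ℝ) (u : Ω → Fin m → ℝ) : ℝ :=
  (∫ a, (Upsilon d P k *ᵥ deviation d μ P k x u a) ⬝ᵥ deviation d μ P k x u a ∂μ)
    + (UpsilonBar d P Pi k *ᵥ meanDeviation d μ P Pi k x u) ⬝ᵥ meanDeviation d μ P Pi k x u

/-- The mean squared deviation of a control from the optimal feedback in one step. -/
noncomputable def deviationSq (d : Data n m N) (μ : Measure Ω)
    (P Pi : ℕ → Matrix (Fin n) (Fin n) ℝ)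
    (k : ℕ) (x : Ω → Fin n → ℝ) (u : Ω → Fin m → ℝ) : ℝ :=
  (∫ a, deviation d μ P k x u a ⬝ᵥ deviation d μ P k x u a ∂μ)
    + meanDeviation d μ P Pi k x u ⬝ᵥ meanDeviation d μ P Pi k x u

theorem isSymm_congr {p q : ℕ} {M : Matrix (Fin p) (Fin p) ℝ} (hM : M.IsSymm)
    (B : Matrix (Fin p) (Fin q) ℝ) : (Bᵀ * M * B).IsSymm := by
  rw [Matrix.IsSymm, Matrix.transpose_mul, Matrix.transpose_mul, hM.eq, Matrix.transpose_transpose,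
    Matrix.mul_assoc]

theorem isSymm_inv {p : ℕ} {M : Matrix (Fin p) (Fin p) ℝ} (hM : M.IsSymm) : M⁻¹.IsSymm := by
  rw [Matrix.IsSymm, Matrix.transpose_nonsing_inv, hM.eq]

theorem isSymm_Upsilon (d : Data n m N) {P : ℕ → Matrix (Fin n) (Fin n) ℝ} {k : ℕ} (hk : k < N)
    (hP : (P (k + 1)).IsSymm) : (Upsilon d P k).IsSymm :=
  ((d.R_symm k hk).add (isSymm_congr hP _)).add (isSymm_congr hP _)

theorem isSymm_UpsilonBar (d : Data n m N) {P Pi : ℕ → Matrix (Fin n) (Fin n) ℝ} {k : ℕ}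
    (hk : k < N) (hP : (P (k + 1)).IsSymm) (hPi : (Pi (k + 1)).IsSymm) :
    (UpsilonBar d P Pi k).IsSymm :=
  (((d.R_symm k hk).add (d.Rb_symm k hk)).add (isSymm_congr hPi _)).add (isSymm_congr hP _)

theorem isSymm_riccatiP (d : Data n m N) {P : ℕ → Matrix (Fin n) (Fin n) ℝ} {k : ℕ} (hk : k < N)
    (hP : (P (k + 1)).IsSymm) : (riccatiP d P k).IsSymm :=
  (((d.Q_symm k hk).add (isSymm_congr hP _)).add (isSymm_congr hP _)).sub
    (isSymm_congr (isSymm_inv (isSymm_Upsilon d hk hP)) _)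

theorem isSymm_riccatiPi (d : Data n m N) {P Pi : ℕ → Matrix (Fin n) (Fin n) ℝ} {k : ℕ}
    (hk : k < N) (hP : (P (k + 1)).IsSymm) (hPi : (Pi (k + 1)).IsSymm) :
    (riccatiPi d P Pi k).IsSymm :=
  ((((d.Q_symm k hk).add (d.Qb_symm k hk)).add (isSymm_congr hPi _)).add (isSymm_congr hP _)).sub
    (isSymm_congr (isSymm_inv (isSymm_UpsilonBar d hk hP hPi)) _)

/-- The optimal feedback law. -/
noncomputable def feedback (d : Data n m N) (μ : Measure Ω) (P Pi : ℕ → Matrix (Fin n) (Fin n) ℝ)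
    (k : ℕ) (x : Ω → Fin n → ℝ) : Ω → Fin m → ℝ := fun a =>
  -(((Upsilon d P k)⁻¹ * crossTerm d P k) *ᵥ (x a - ∫ b, x b ∂μ))
    - ((UpsilonBar d P Pi k)⁻¹ * crossTermBar d P Pi k) *ᵥ (∫ b, x b ∂μ)

/-- The state under the optimal feedback law. -/
noncomputable def closedLoop (d : Data n m N) (μ : Measure Ω) (ω : ℕ → Ω → ℝ)
    (P Pi : ℕ → Matrix (Fin n) (Fin n) ℝ) (l : ℕ) (ξ : Ω → Fin n → ℝ) : ℕ → Ω → Fin n → ℝ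
  | 0 => ξ
  | k + 1 =>
    if k < l then ξ
    else step d μ ω k (closedLoop d μ ω P Pi l ξ k)
      (feedback d μ P Pi k (closedLoop d μ ω P Pi l ξ k))

/-- The feedback control needs the state, which in turn needs the control; `closedLoop` breaks the
circle by its own recursion, and this lemma shows that both descriptions agree. -/
theorem state_feedback (d : Data n m N) (ω : ℕ → Ω → ℝ) (P Pi : ℕ → Matrix (Fin n) (Fin n) ℝ)
    (l : ℕ) (ξ : Ω → Fin n → ℝ) (k : ℕ) :
    state d μ ω l ξ (fun k => feedback d μ P Pi k (closedLoop d μ ω P Pi l ξ k)) k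
      = closedLoop d μ ω P Pi l ξ k := by
  induction k with
  | zero => rfl
  | succ k ih =>
    rcases lt_or_ge k l with h | h
    · rw [state_of_le d ω ξ _ h, closedLoop, if_pos h]
    · rw [state_succ d ω ξ _ h, ih, closedLoop, if_neg (not_lt.2 h)]

theorem memLp_deviation [IsProbabilityMeasure μ] (d : Data n m N)
    (P : ℕ → Matrix (Fin n) (Fin n) ℝ) (k : ℕ) {x : Ω → Fin n → ℝ} {u : Ω → Fin m → ℝ}
    (hx : MemLp x 2 μ) (hu : MemLp u 2 μ) : MemLp (deviation d μ P k x u) 2 μ :=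
  (memLp_center hu).add (memLp_mulVec _ (memLp_center hx))

theorem mul_deviationSq_le_excess [IsProbabilityMeasure μ] (d : Data n m N)
    {P Pi : ℕ → Matrix (Fin n) (Fin n) ℝ} {k : ℕ} {α : ℝ}
    (hU : (Upsilon d P k - α • 1).PosSemidef) (hUb : (UpsilonBar d P Pi k - α • 1).PosSemidef)
    {x : Ω → Fin n → ℝ} {u : Ω → Fin m → ℝ} (hx : MemLp x 2 μ) (hu : MemLp u 2 μ) :
    α * deviationSq d μ P Pi k x u ≤ excess d μ P Pi k x u := by
  have hd := memLp_deviation d P k hx hu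
  rw [deviationSq, excess, mul_add, ← integral_const_mul]
  exact add_le_add (integral_mono ((integrable_dotProduct hd hd).const_mul α)
    (integrable_dotProduct (memLp_mulVec _ hd) hd)
    fun a => mul_dotProduct_self_le_of_posSemidef_sub hU _)
    (mul_dotProduct_self_le_of_posSemidef_sub hUb _)

theorem deviationSq_nonneg (d : Data n m N) (P Pi : ℕ → Matrix (Fin n) (Fin n) ℝ) (k : ℕ)
    (x : Ω → Fin n → ℝ) (u : Ω → Fin m → ℝ) : 0 ≤ deviationSq d μ P Pi k x u :=
  add_nonneg (integral_nonneg fun _ => dotProduct_self_nonneg' _) (dotProduct_self_nonneg' _)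

variable [IsProbabilityMeasure μ]

/-- The dynamic programming identity, with one completed square in the fluctuation (`e1`) and one in
the mean (`e2`). The barred stage cost enters only the second. -/
theorem meanForm_step_add_stageCost {ℱ : Filtration ℕ mΩ} {ω : ℕ → Ω → ℝ} (hω : IsNoise μ ℱ ω N)
    (d : Data n m N) {P Pi : ℕ → Matrix (Fin n) (Fin n) ℝ} {k : ℕ} (hk : k < N)
    (hP : (P (k + 1)).IsSymm) (hPi : (Pi (k + 1)).IsSymm) (hU : IsUnit (Upsilon d P k).det)
    (hUb : IsUnit (UpsilonBar d P Pi k).det) {x : Ω → Fin n → ℝ} {u : Ω → Fin m → ℝ}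
    (hxm : Measurable[ℱ k] x) (hx : MemLp x 2 μ) (hum : Measurable[ℱ k] u) (hu : MemLp u 2 μ) :
    meanForm μ (P (k + 1)) (Pi (k + 1)) (step d μ ω k x u)
        + (∫ a, blockForm (d.Q k) (d.S k) (d.R k) (x a) (u a) ∂μ
          + blockForm (d.Qb k) (d.Sb k) (d.Rb k) (∫ b, x b ∂μ) (∫ b, u b ∂μ))
      = meanForm μ (riccatiP d P k) (riccatiPi d P Pi k) x + excess d μ P Pi k x u := by
  have hcx := memLp_center hx
  have hcu := memLp_center hu
  have e1 : ∀ (y : Fin n → ℝ) (v : Fin m → ℝ),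
      blockForm ((d.A k)ᵀ * P (k + 1) * d.A k + (d.C k)ᵀ * P (k + 1) * d.C k)
          ((d.B k)ᵀ * P (k + 1) * d.A k + (d.D k)ᵀ * P (k + 1) * d.C k)
          ((d.B k)ᵀ * P (k + 1) * d.B k + (d.D k)ᵀ * P (k + 1) * d.D k) y v
        + blockForm (d.Q k) (d.S k) (d.R k) y v
      = (riccatiP d P k *ᵥ y) ⬝ᵥ y
        + (Upsilon d P k *ᵥ (v + ((Upsilon d P k)⁻¹ * crossTerm d P k) *ᵥ y))
          ⬝ᵥ (v + ((Upsilon d P k)⁻¹ * crossTerm d P k) *ᵥ y) := by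
    intro y v
    rw [riccatiP, ← blockForm_completeSquare _ _ (isSymm_Upsilon d hk hP)
      (Matrix.mul_nonsing_inv _ hU), ← blockForm_add]
    congr 1
    · abel
    · rw [Upsilon]; abel
  have e2 : ∀ (y : Fin n → ℝ) (v : Fin m → ℝ),
      blockForm ((d.A k + d.Ab k)ᵀ * Pi (k + 1) * (d.A k + d.Ab k)
            + (d.C k + d.Cb k)ᵀ * P (k + 1) * (d.C k + d.Cb k))
          ((d.B k + d.Bb k)ᵀ * Pi (k + 1) * (d.A k + d.Ab k)
            + (d.D k + d.Db k)ᵀ * P (k + 1) * (d.C k + d.Cb k))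
          ((d.B k + d.Bb k)ᵀ * Pi (k + 1) * (d.B k + d.Bb k)
            + (d.D k + d.Db k)ᵀ * P (k + 1) * (d.D k + d.Db k)) y v
        + blockForm (d.Q k) (d.S k) (d.R k) y v + blockForm (d.Qb k) (d.Sb k) (d.Rb k) y v
      = (riccatiPi d P Pi k *ᵥ y) ⬝ᵥ y
        + (UpsilonBar d P Pi k *ᵥ (v + ((UpsilonBar d P Pi k)⁻¹ * crossTermBar d P Pi k) *ᵥ y))
          ⬝ᵥ (v + ((UpsilonBar d P Pi k)⁻¹ * crossTermBar d P Pi k) *ᵥ y) := by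
    intro y v
    rw [riccatiPi, ← blockForm_completeSquare _ _ (isSymm_UpsilonBar d hk hP hPi)
      (Matrix.mul_nonsing_inv _ hUb), ← blockForm_add, ← blockForm_add]
    congr 1
    · abel
    · rw [crossTermBar]; abel
    · rw [UpsilonBar]; abel
  have hd := memLp_deviation d P k hx hu
  -- The left integrand is filled in by unification with `e1`.
  have h1 : ∫ a, _ ∂μ = ∫ a, ((riccatiP d P k *ᵥ (x a - ∫ b, x b ∂μ)) ⬝ᵥ (x a - ∫ b, x b ∂μ)
      + (Upsilon d P k *ᵥ deviation d μ P k x u a) ⬝ᵥ deviation d μ P k x u a) ∂μ :=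
    integral_congr_ae (ae_of_all _ fun a => e1 (x a - ∫ b, x b ∂μ) (u a - ∫ b, u b ∂μ))
  rw [integral_add (integrable_blockForm _ _ _ hcx hcu) (integrable_blockForm _ _ _ hcx hcu),
    integral_add (integrable_dotProduct (memLp_mulVec _ hcx) hcx)
      (integrable_dotProduct (memLp_mulVec _ hd) hd)] at h1
  have h2 := e2 (∫ b, x b ∂μ) (∫ b, u b ∂μ)
  rw [meanForm_step hω d hk hP hPi hxm hx hum hu, integral_blockForm_center _ _ _ hx hu, meanForm,
    excess]
  simp only [deviation, meanDeviation] at h1 ⊢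
  linarith

theorem state_regular {ℱ : Filtration ℕ mΩ} {ω : ℕ → Ω → ℝ} (hω : IsNoise μ ℱ ω N)
    (d : Data n m N) {l : ℕ} {ξ : Ω → Fin n → ℝ} (hξm : Measurable[ℱ l] ξ) (hξ : MemLp ξ 2 μ)
    {u : ℕ → Ω → Fin m → ℝ} (hu : u ∈ admissible μ ℱ m N l) {k : ℕ} (hlk : l ≤ k) (hk : k ≤ N) :
    Measurable[ℱ k] (state d μ ω l ξ u k) ∧ MemLp (state d μ ω l ξ u k) 2 μ := by
  induction k, hlk using Nat.le_induction with
  | base => rw [state_of_le d ω ξ u le_rfl]; exact ⟨hξm, hξ⟩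
  | succ k hlk ih =>
    obtain ⟨h1, h2⟩ := ih (Nat.le_of_succ_le hk)
    obtain ⟨h3, h4⟩ := hu k hlk hk
    rw [state_succ d ω ξ u hlk]
    exact ⟨measurable_step hω d hk h1 h3, memLp_step hω d hk h1 h2 h3 h4⟩

theorem integrable_runningCost {ℱ : Filtration ℕ mΩ} {ω : ℕ → Ω → ℝ} (hω : IsNoise μ ℱ ω N)
    (d : Data n m N) {l : ℕ} {ξ : Ω → Fin n → ℝ} (hξm : Measurable[ℱ l] ξ)
    (hξ : MemLp ξ 2 μ) {u : ℕ → Ω → Fin m → ℝ} (hu : u ∈ admissible μ ℱ m N l) {k : ℕ}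
    (hk : k ∈ Finset.Ico l N) :
    Integrable (fun a => blockForm (d.Q k) (d.S k) (d.R k) (state d μ ω l ξ u k a) (u k a)) μ := by
  obtain ⟨hlk, hk⟩ := Finset.mem_Ico.1 hk
  exact integrable_blockForm _ _ _ (state_regular hω d hξm hξ hu hlk hk.le).2 (hu k hlk hk).2

theorem cost_eq_meanForm_add_sum {ℱ : Filtration ℕ mΩ} {ω : ℕ → Ω → ℝ} (hω : IsNoise μ ℱ ω N)
    (d : Data n m N) {l : ℕ} (hl : l ≤ N) {ξ : Ω → Fin n → ℝ} (hξm : Measurable[ℱ l] ξ)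
    (hξ : MemLp ξ 2 μ) {u : ℕ → Ω → Fin m → ℝ} (hu : u ∈ admissible μ ℱ m N l) :
    cost d μ ω l ξ u = meanForm μ d.G (d.G + d.Gb) (state d μ ω l ξ u N)
      + ∑ k ∈ Finset.Ico l N,
        (∫ a, blockForm (d.Q k) (d.S k) (d.R k) (state d μ ω l ξ u k a) (u k a) ∂μ
          + blockForm (d.Qb k) (d.Sb k) (d.Rb k) (∫ b, state d μ ω l ξ u k b ∂μ)
            (∫ b, u k b ∂μ)) := by
  have hN := (state_regular hω d hξm hξ hu hl le_rfl).2
  have i1 : Integrable (fun a => (d.G *ᵥ state d μ ω l ξ u N a) ⬝ᵥ state d μ ω l ξ u N a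
      + (d.Gb *ᵥ (∫ b, state d μ ω l ξ u N b ∂μ)) ⬝ᵥ (∫ b, state d μ ω l ξ u N b ∂μ)) μ :=
    (integrable_dotProduct (memLp_mulVec d.G hN) hN).add (integrable_const _)
  rw [cost, ← integral_quadForm_add_eq_meanForm d.G d.Gb hN]
  rw [integral_add_add i1 (integrable_finsetSum _ fun k hk =>
      integrable_runningCost hω d hξm hξ hu hk) (integrable_const _),
    integral_finsetSum _ fun k hk => integrable_runningCost hω d hξm hξ hu hk,
    integral_add (integrable_dotProduct (memLp_mulVec d.G hN) hN) (integrable_const _),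
    Finset.sum_add_distrib]
  simp only [integral_const, probReal_univ, smul_eq_mul, one_mul, add_assoc]

/-- The one-step identity telescoped. The Riccati equations are not assumed, so their defect stays
in the sum; this lets the formula be used inside the induction that proves them. -/
theorem cost_eq_meanForm_add_sum_excess {ℱ : Filtration ℕ mΩ} {ω : ℕ → Ω → ℝ}
    (hω : IsNoise μ ℱ ω N) (d : Data n m N) {P Pi : ℕ → Matrix (Fin n) (Fin n) ℝ}
    (hP : ∀ k ≤ N, (P k).IsSymm) (hPi : ∀ k ≤ N, (Pi k).IsSymm) (hPN : P N = d.G)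
    (hPiN : Pi N = d.G + d.Gb) (hU : ∀ k < N, IsUnit (Upsilon d P k).det)
    (hUb : ∀ k < N, IsUnit (UpsilonBar d P Pi k).det) {l : ℕ} (hl : l ≤ N)
    {ξ : Ω → Fin n → ℝ} (hξm : Measurable[ℱ l] ξ)
    (hξ : MemLp ξ 2 μ) {u : ℕ → Ω → Fin m → ℝ} (hu : u ∈ admissible μ ℱ m N l) :
    cost d μ ω l ξ u = meanForm μ (P l) (Pi l) ξ + ∑ k ∈ Finset.Ico l N,
      (meanForm μ (riccatiP d P k) (riccatiPi d P Pi k) (state d μ ω l ξ u k)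
        - meanForm μ (P k) (Pi k) (state d μ ω l ξ u k)
        + excess d μ P Pi k (state d μ ω l ξ u k) (u k)) := by
  have htel := Finset.sum_Ico_sub
    (fun k => meanForm μ (P k) (Pi k) (state d μ ω l ξ u k)) hl
  rw [cost_eq_meanForm_add_sum hω d hl hξm hξ hu, ← hPiN, ← hPN]
  rw [state_of_le d ω ξ u le_rfl] at htel
  rw [sub_eq_iff_eq_add'.1 htel.symm, add_assoc, ← Finset.sum_add_distrib]
  congr 1
  refine Finset.sum_congr rfl fun k hk => ?_
  obtain ⟨hlk, hk⟩ := Finset.mem_Ico.1 hk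
  obtain ⟨h1, h2⟩ := state_regular hω d hξm hξ hu hlk hk.le
  obtain ⟨h3, h4⟩ := hu k hlk hk
  rw [state_succ d ω ξ u hlk]
  linarith [meanForm_step_add_stageCost hω d hk (hP _ hk) (hPi _ hk) (hU k hk) (hUb k hk)
    h1 h2 h3 h4]

theorem feedback_regular {ℱ : Filtration ℕ mΩ} (d : Data n m N)
    (P Pi : ℕ → Matrix (Fin n) (Fin n) ℝ) {k : ℕ} {x : Ω → Fin n → ℝ} (hxm : Measurable[ℱ k] x)
    (hx : MemLp x 2 μ) :
    Measurable[ℱ k] (feedback d μ P Pi k x) ∧ MemLp (feedback d μ P Pi k x) 2 μ :=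
  ⟨(measurable_mulVec _ (hxm.sub_const _)).neg.sub_const _,
    (memLp_mulVec _ (memLp_center hx)).neg.sub (memLp_const _)⟩

theorem closedLoop_regular {ℱ : Filtration ℕ mΩ} {ω : ℕ → Ω → ℝ} (hω : IsNoise μ ℱ ω N)
    (d : Data n m N) (P Pi : ℕ → Matrix (Fin n) (Fin n) ℝ) {l : ℕ} {ξ : Ω → Fin n → ℝ}
    (hξm : Measurable[ℱ l] ξ) (hξ : MemLp ξ 2 μ) {k : ℕ} (hlk : l ≤ k) (hk : k ≤ N) :
    Measurable[ℱ k] (closedLoop d μ ω P Pi l ξ k) ∧ MemLp (closedLoop d μ ω P Pi l ξ k) 2 μ := by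
  induction k, hlk using Nat.le_induction with
  | base =>
    rw [← state_feedback, state_of_le d ω ξ _ le_rfl]
    exact ⟨hξm, hξ⟩
  | succ k hlk ih =>
    obtain ⟨h1, h2⟩ := ih (Nat.le_of_succ_le hk)
    obtain ⟨h3, h4⟩ := feedback_regular d P Pi h1 h2
    rw [closedLoop, if_neg (not_lt.2 hlk)]
    exact ⟨measurable_step hω d hk h1 h3, memLp_step hω d hk h1 h2 h3 h4⟩

theorem excess_feedback (d : Data n m N) (P Pi : ℕ → Matrix (Fin n) (Fin n) ℝ) (k : ℕ)
    {x : Ω → Fin n → ℝ} (hx : MemLp x 2 μ) :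
    excess d μ P Pi k x (feedback d μ P Pi k x) = 0 := by
  have hc := memLp_center hx
  have hmean : ∫ a, feedback d μ P Pi k x a ∂μ
      = -(((UpsilonBar d P Pi k)⁻¹ * crossTermBar d P Pi k) *ᵥ (∫ b, x b ∂μ)) := by
    have hi := (memLp_mulVec ((Upsilon d P k)⁻¹ * crossTerm d P k) hc).integrable one_le_two
    simp only [feedback]
    rw [integral_sub (f := fun a => -(((Upsilon d P k)⁻¹ * crossTerm d P k) *ᵥ
      (x a - ∫ b, x b ∂μ))) hi.neg (integrable_const _), integral_neg, integral_mulVec _ (hc.integrable one_le_two), integral_center hx]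
    simp
  have h1 : ∀ a, deviation d μ P k x (feedback d μ P Pi k x) a = 0 := fun a => by
    rw [deviation, hmean, feedback]
    abel
  have h2 : meanDeviation d μ P Pi k x (feedback d μ P Pi k x) = 0 := by
    rw [meanDeviation, hmean, neg_add_cancel]
  simp [excess, h1, h2]

/-- The Riccati equations are assumed only strictly after `l`; this is the inductive step of the
backward recursion. The feedback attains the lower bound given by nonnegativity of the excesses. -/
theorem value_eq_meanForm_riccati {ℱ : Filtration ℕ mΩ} {ω : ℕ → Ω → ℝ}
    (hω : IsNoise μ ℱ ω N) (d : Data n m N) {P Pi : ℕ → Matrix (Fin n) (Fin n) ℝ}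
    (hP : ∀ k ≤ N, (P k).IsSymm) (hPi : ∀ k ≤ N, (Pi k).IsSymm) (hPN : P N = d.G)
    (hPiN : Pi N = d.G + d.Gb) {α : ℝ} (hα : 0 < α)
    (hU : ∀ k < N, (Upsilon d P k - α • 1).PosSemidef)
    (hUb : ∀ k < N, (UpsilonBar d P Pi k - α • 1).PosSemidef) {l : ℕ} (hl : l < N)
    (hric : ∀ k, l < k → k < N → P k = riccatiP d P k ∧ Pi k = riccatiPi d P Pi k)
    {ξ : Ω → Fin n → ℝ} (hξm : Measurable[ℱ l] ξ) (hξ : MemLp ξ 2 μ) :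
    value d μ ℱ ω l ξ = (meanForm μ (riccatiP d P l) (riccatiPi d P Pi l) ξ : ℝ) := by
  have hcost : ∀ u ∈ admissible μ ℱ m N l, cost d μ ω l ξ u
      = meanForm μ (riccatiP d P l) (riccatiPi d P Pi l) ξ
        + ∑ k ∈ Finset.Ico l N, excess d μ P Pi k (state d μ ω l ξ u k) (u k) := by
    intro u hu
    rw [cost_eq_meanForm_add_sum_excess hω d hP hPi hPN hPiN
      (fun k hk => isUnit_det_of_posSemidef_sub hα (hU k hk))
      (fun k hk => isUnit_det_of_posSemidef_sub hα (hUb k hk)) hl.le hξm hξ hu,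
      -- At `k = l` the form of `P l` and `Pi l` cancels the leading term and leaves the Riccati
      -- form; for `k > l` the defect vanishes by `hric`.
      Finset.sum_eq_sum_Ico_succ_bot hl, Finset.sum_eq_sum_Ico_succ_bot hl,
      state_of_le d ω ξ u le_rfl, Finset.sum_congr (g := fun k =>
        excess d μ P Pi k (state d μ ω l ξ u k) (u k)) rfl fun k hk => ?_]
    · ring
    · obtain ⟨h1, h2⟩ := Finset.mem_Ico.1 hk
      obtain ⟨h3, h4⟩ := hric k h1 h2
      rw [← h3, ← h4]
      ring
  refine le_antisymm ?_ ?_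
  · have hreg := fun k (hlk : l ≤ k) (hk : k < N) =>
      closedLoop_regular hω d P Pi hξm hξ hlk hk.le
    have hadm : (fun k => feedback d μ P Pi k (closedLoop d μ ω P Pi l ξ k))
        ∈ admissible μ ℱ m N l := fun k hlk hk =>
      feedback_regular d P Pi (hreg k hlk hk).1 (hreg k hlk hk).2
    refine (iInf₂_le _ hadm).trans (EReal.coe_le_coe_iff.2 ?_)
    rw [hcost _ hadm, Finset.sum_eq_zero, add_zero]
    intro k hk
    obtain ⟨h1, h2⟩ := Finset.mem_Ico.1 hk
    rw [state_feedback, excess_feedback d P Pi k (hreg k h1 h2).2]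
  · refine le_iInf₂ fun u hu => EReal.coe_le_coe_iff.2 ?_
    rw [hcost u hu]
    refine le_add_of_nonneg_right (Finset.sum_nonneg fun k hk => ?_)
    obtain ⟨h1, h2⟩ := Finset.mem_Ico.1 hk
    exact (mul_nonneg hα.le (deviationSq_nonneg d P Pi k _ _)).trans
      (mul_deviationSq_le_excess d (hU k h2) (hUb k h2)
        (state_regular hω d hξm hξ hu h1 h2.le).2 (hu k h1 h2).2)

end Riccati

/-! ### Recovering the matrices from the values on initial states. -/

section Identification

variable {Ω : Type*} {mΩ : MeasurableSpace Ω} {μ : Measure Ω} {n m N : ℕ}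

theorem IsInitialState.smul_vec {ℱ : Filtration ℕ mΩ} {ω : ℕ → Ω → ℝ} {η : Ω → ℝ} {k l : ℕ}
    (hη : IsInitialState μ ℱ ω N k η) (hkl : k ≤ l) (v : Fin n → ℝ) :
    IsInitialState μ ℱ ω N l (fun a => η a • v) where
  measurable := (hη.measurable.mono (ℱ.mono hkl) le_rfl).smul_const v
  memLp := memLp_of_apply fun i => hη.memLp.mul_const (v i)
  indep := hη.indep.comp (measurable_id.smul_const v) measurable_id

theorem meanForm_smul_vec (P Pi : Matrix (Fin n) (Fin n) ℝ) (η : Ω → ℝ) (v : Fin n → ℝ) :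
    meanForm μ P Pi (fun a => η a • v) = (∫ a, (η a - ∫ b, η b ∂μ) ^ 2 ∂μ) * ((P *ᵥ v) ⬝ᵥ v)
      + (∫ b, η b ∂μ) ^ 2 * ((Pi *ᵥ v) ⬝ᵥ v) := by
  have e : ∀ (M : Matrix (Fin n) (Fin n) ℝ) (r : ℝ), (M *ᵥ (r • v)) ⬝ᵥ (r • v)
      = r ^ 2 * ((M *ᵥ v) ⬝ᵥ v) := fun M r => by
    simp only [Matrix.mulVec_smul, smul_dotProduct, dotProduct_smul, smul_eq_mul]
    ring
  rw [meanForm, integral_smul_const]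
  simp only [← sub_smul, e]
  rw [integral_mul_const]

variable [IsProbabilityMeasure μ]

theorem isInitialState_const {E : Type*} [NormedAddCommGroup E] [MeasurableSpace E]
    (ℱ : Filtration ℕ mΩ) (ω : ℕ → Ω → ℝ) (N l : ℕ) (v : E) :
    IsInitialState μ ℱ ω N l (fun _ => v) where
  measurable := measurable_const
  memLp := memLp_const v
  indep := indepFun_const_left v _

theorem meanForm_const (P Pi : Matrix (Fin n) (Fin n) ℝ) (v : Fin n → ℝ) :
    meanForm μ P Pi (fun _ => v) = (Pi *ᵥ v) ⬝ᵥ v := by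
  simp [meanForm]

theorem integral_sub_integral_sq_ne_zero {η : Ω → ℝ} (hη : MemLp η 2 μ)
    (hne : ¬ ∃ c : ℝ, η =ᵐ[μ] fun _ => c) : ∫ a, (η a - ∫ b, η b ∂μ) ^ 2 ∂μ ≠ 0 := by
  intro h
  have hL : MemLp (fun a => η a - ∫ b, η b ∂μ) 2 μ := hη.sub (memLp_const _)
  rw [integral_eq_zero_iff_of_nonneg (fun a => sq_nonneg _) hL.integrable_sq] at h
  refine hne ⟨∫ b, η b ∂μ, h.mono fun a ha => ?_⟩
  simpa [sub_eq_zero] using ha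

/-- Deterministic states have no fluctuation and isolate `Pi`. On `η v` the `Pi` terms then cancel
and the nonzero variance of `η` can be divided out. -/
theorem eq_of_meanForm_eq {ℱ : Filtration ℕ mΩ} {ω : ℕ → Ω → ℝ} {η : Ω → ℝ}
    (hη : IsInitialState μ ℱ ω N 0 η) (hne : ¬ ∃ c : ℝ, η =ᵐ[μ] fun _ => c) (l : ℕ)
    {P P' Pi Pi' : Matrix (Fin n) (Fin n) ℝ} (hP : P.IsSymm) (hP' : P'.IsSymm)
    (hPi : Pi.IsSymm) (hPi' : Pi'.IsSymm)
    (h : ∀ ξ : Ω → Fin n → ℝ, IsInitialState μ ℱ ω N l ξ →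
      meanForm μ P Pi ξ = meanForm μ P' Pi' ξ) : P = P' ∧ Pi = Pi' := by
  have hpi : ∀ v, (Pi *ᵥ v) ⬝ᵥ v = (Pi' *ᵥ v) ⬝ᵥ v := fun v => by
    simpa only [meanForm_const] using h _ (isInitialState_const ℱ ω N l v)
  refine ⟨eq_of_quadForm_eq hP hP' fun v => ?_, eq_of_quadForm_eq hPi hPi' hpi⟩
  have hv := h _ (hη.smul_vec (Nat.zero_le l) v)
  rw [meanForm_smul_vec, meanForm_smul_vec, hpi v] at hv
  exact mul_left_cancel₀ (integral_sub_integral_sq_ne_zero hη.memLp hne) (add_right_cancel hv)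

theorem value_terminal {ℱ : Filtration ℕ mΩ} {ω : ℕ → Ω → ℝ} (hω : IsNoise μ ℱ ω N)
    (d : Data n m N) {ξ : Ω → Fin n → ℝ} (hξm : Measurable[ℱ N] ξ) (hξ : MemLp ξ 2 μ) :
    value d μ ℱ ω N ξ = (meanForm μ d.G (d.G + d.Gb) ξ : ℝ) := by
  have hc : ∀ u ∈ admissible μ ℱ m N N, cost d μ ω N ξ u = meanForm μ d.G (d.G + d.Gb) ξ := by
    intro u hu
    rw [cost_eq_meanForm_add_sum hω d le_rfl hξm hξ hu, state_of_le d ω ξ u le_rfl]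
    simp
  -- With no time left admissibility is vacuous; a witness is still needed so that the infimum is
  -- not `⊤`.
  have h0 : (0 : ℕ → Ω → Fin m → ℝ) ∈ admissible μ ℱ m N N :=
    fun k h1 h2 => absurd h1 (not_le.2 h2)
  refine le_antisymm ((iInf₂_le _ h0).trans (EReal.coe_le_coe_iff.2 (hc 0 h0).le))
    (le_iInf₂ fun u hu => EReal.coe_le_coe_iff.2 (hc u hu).ge)

theorem terminal_of_valueRepresentation {ℱ : Filtration ℕ mΩ} {ω : ℕ → Ω → ℝ}
    (hω : IsNoise μ ℱ ω N) {η : Ω → ℝ} (hη : IsInitialState μ ℱ ω N 0 η)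
    (hne : ¬ ∃ c : ℝ, η =ᵐ[μ] fun _ => c) (d : Data n m N)
    {P Pi : ℕ → Matrix (Fin n) (Fin n) ℝ} (hP : ∀ k ≤ N, (P k).IsSymm)
    (hPi : ∀ k ≤ N, (Pi k).IsSymm) (hrep : ValueRepresentation d μ ℱ ω P Pi) :
    P N = d.G ∧ Pi N = d.G + d.Gb := by
  refine eq_of_meanForm_eq hη hne N (hP N le_rfl) d.G_symm (hPi N le_rfl)
    (d.G_symm.add d.Gb_symm) fun ξ hξ => ?_
  have h := (hrep N le_rfl ξ hξ).symm.trans (value_terminal hω d hξ.measurable hξ.memLp)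
  exact EReal.coe_injective h

theorem riccati_of_valueRepresentation {ℱ : Filtration ℕ mΩ} {ω : ℕ → Ω → ℝ}
    (hω : IsNoise μ ℱ ω N) {η : Ω → ℝ} (hη : IsInitialState μ ℱ ω N 0 η)
    (hne : ¬ ∃ c : ℝ, η =ᵐ[μ] fun _ => c) (d : Data n m N)
    {P Pi : ℕ → Matrix (Fin n) (Fin n) ℝ} (hP : ∀ k ≤ N, (P k).IsSymm)
    (hPi : ∀ k ≤ N, (Pi k).IsSymm) (hrep : ValueRepresentation d μ ℱ ω P Pi) {α : ℝ}
    (hα : 0 < α) (hU : ∀ k < N, (Upsilon d P k - α • 1).PosSemidef)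
    (hUb : ∀ k < N, (UpsilonBar d P Pi k - α • 1).PosSemidef) {k : ℕ} (hk : k < N) :
    P k = riccatiP d P k ∧ Pi k = riccatiPi d P Pi k := by
  obtain ⟨hPN, hPiN⟩ := terminal_of_valueRepresentation hω hη hne d hP hPi hrep
  -- Backward induction on the number of remaining steps: the bound `j` covers every time `l ≥ N -
  -- j`, hence all times after the current one.
  have key : ∀ j l, N ≤ l + j → l < N → P l = riccatiP d P l ∧ Pi l = riccatiPi d P Pi l := by
    intro j
    induction j with
    | zero => exact fun l h1 h2 => absurd h1 (not_le.2 h2)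
    | succ j ih =>
      intro l hlj hl
      refine eq_of_meanForm_eq hη hne l (hP l hl.le) (isSymm_riccatiP d hl (hP _ hl))
        (hPi l hl.le) (isSymm_riccatiPi d hl (hP _ hl) (hPi _ hl)) fun ξ hξ => ?_
      have h := (hrep l hl.le ξ hξ).symm.trans (value_eq_meanForm_riccati hω d hP hPi hPN hPiN
        hα hU hUb hl (fun k hlk hk => ih k (by omega) hk) hξ.measurable hξ.memLp)
      exact EReal.coe_injective h
  exact key N k (Nat.le_add_left N k) hk

end Identification

/-! ### Bounding the control by its deviations from the feedback. -/

section Coercivity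

variable {Ω : Type*} {mΩ : MeasurableSpace Ω} {μ : Measure Ω} {n m N : ℕ}

/-- The mean square `𝔼|X|²`. -/
noncomputable def meanSq (μ : Measure Ω) (X : Ω → Fin n → ℝ) : ℝ := ∫ a, X a ⬝ᵥ X a ∂μ

theorem meanSq_nonneg (X : Ω → Fin n → ℝ) : 0 ≤ meanSq μ X :=
  integral_nonneg fun _ => dotProduct_self_nonneg' _

theorem energy_eq_sum {ℱ : Filtration ℕ mΩ} {u : ℕ → Ω → Fin m → ℝ} {l : ℕ}
    (hu : u ∈ admissible μ ℱ m N l) : energy μ N l u = ∑ k ∈ Finset.Ico l N, meanSq μ (u k) :=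
  integral_finsetSum _ fun k hk =>
    have h := (hu k (Finset.mem_Ico.1 hk).1 (Finset.mem_Ico.1 hk).2).2
    integrable_dotProduct h h

variable [IsProbabilityMeasure μ]

theorem meanSq_eq_center_add {X : Ω → Fin n → ℝ} (hX : MemLp X 2 μ) :
    meanSq μ X = meanSq μ (fun a => X a - ∫ b, X b ∂μ) + (∫ b, X b ∂μ) ⬝ᵥ (∫ b, X b ∂μ) := by
  have h := meanForm_one hX
  simp only [meanForm, Matrix.one_mulVec] at h
  exact h.symm

/-- `meanForm_step` with both weights equal to the identity, so that the form is the mean square. -/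
theorem exists_meanSq_step_le {ℱ : Filtration ℕ mΩ} {ω : ℕ → Ω → ℝ} (hω : IsNoise μ ℱ ω N)
    (d : Data n m N) {k : ℕ} (hk : k < N) :
    ∃ c : ℝ, 0 ≤ c ∧ ∀ (x : Ω → Fin n → ℝ) (u : Ω → Fin m → ℝ), Measurable[ℱ k] x → MemLp x 2 μ →
      Measurable[ℱ k] u → MemLp u 2 μ →
      meanSq μ (step d μ ω k x u) ≤ c * (meanSq μ x + meanSq μ u) := by
  let I : Matrix (Fin n) (Fin n) ℝ := 1
  obtain ⟨c₁, hc₁, h₁⟩ := exists_blockForm_le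
    ((d.A k)ᵀ * I * d.A k + (d.C k)ᵀ * I * d.C k) ((d.B k)ᵀ * I * d.A k + (d.D k)ᵀ * I * d.C k)
    ((d.B k)ᵀ * I * d.B k + (d.D k)ᵀ * I * d.D k)
  obtain ⟨c₂, hc₂, h₂⟩ := exists_blockForm_le
    ((d.A k + d.Ab k)ᵀ * I * (d.A k + d.Ab k) + (d.C k + d.Cb k)ᵀ * I * (d.C k + d.Cb k))
    ((d.B k + d.Bb k)ᵀ * I * (d.A k + d.Ab k) + (d.D k + d.Db k)ᵀ * I * (d.C k + d.Cb k))
    ((d.B k + d.Bb k)ᵀ * I * (d.B k + d.Bb k) + (d.D k + d.Db k)ᵀ * I * (d.D k + d.Db k))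
  refine ⟨c₁ + c₂, add_nonneg hc₁ hc₂, fun x u hxm hx hum hu => ?_⟩
  have hcx := memLp_center hx
  have hcu := memLp_center hu
  have h := integral_mono (μ := μ) (integrable_blockForm _ _ _ hcx hcu)
    (((integrable_dotProduct hcx hcx).add (integrable_dotProduct hcu hcu)).const_mul c₁)
    fun a => h₁ (x a - ∫ b, x b ∂μ) (u a - ∫ b, u b ∂μ)
  rw [integral_const_mul, integral_add' (integrable_dotProduct hcx hcx)
    (integrable_dotProduct hcu hcu)] at h
  have h' := h₂ (∫ b, x b ∂μ) (∫ b, u b ∂μ)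
  rw [meanSq, ← meanForm_one (memLp_step hω d hk hxm hx hum hu),
    meanForm_step hω d hk Matrix.isSymm_one Matrix.isSymm_one hxm hx hum hu,
    meanSq_eq_center_add hx, meanSq_eq_center_add hu]
  have p1 := meanSq_nonneg (μ := μ) fun a => x a - ∫ b, x b ∂μ
  have p2 := meanSq_nonneg (μ := μ) fun a => u a - ∫ b, u b ∂μ
  have p3 := dotProduct_self_nonneg' (∫ b, x b ∂μ)
  have p4 := dotProduct_self_nonneg' (∫ b, u b ∂μ)
  refine (add_le_add h h').trans ?_
  change c₁ * (meanSq μ _ + meanSq μ _) + _ ≤ _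
  nlinarith [mul_nonneg hc₂ (add_nonneg p1 p2), mul_nonneg hc₁ (add_nonneg p3 p4)]

/-- A control is its deviation minus a fixed linear function of the state, both for the fluctuation
and for the mean. -/
theorem exists_meanSq_control_le (d : Data n m N) (P Pi : ℕ → Matrix (Fin n) (Fin n) ℝ) (k : ℕ) :
    ∃ c : ℝ, 0 ≤ c ∧ ∀ (x : Ω → Fin n → ℝ) (u : Ω → Fin m → ℝ), MemLp x 2 μ → MemLp u 2 μ →
      meanSq μ u ≤ c * (meanSq μ x + deviationSq d μ P Pi k x u) := by
  obtain ⟨c₁, hc₁, h₁⟩ := exists_mulVec_sq_le ((Upsilon d P k)⁻¹ * crossTerm d P k)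
  obtain ⟨c₂, hc₂, h₂⟩ := exists_mulVec_sq_le ((UpsilonBar d P Pi k)⁻¹ * crossTermBar d P Pi k)
  refine ⟨2 * c₁ + 2 * c₂ + 2, by positivity, fun x u hx hu => ?_⟩
  have hcx := memLp_center hx
  have hcu := memLp_center hu
  have hd := memLp_deviation d P k hx hu
  have h : meanSq μ (fun a => u a - ∫ b, u b ∂μ) ≤ 2 * meanSq μ (deviation d μ P k x u)
      + 2 * c₁ * meanSq μ (fun a => x a - ∫ b, x b ∂μ) := by
    simp only [meanSq]
    rw [← integral_const_mul, ← integral_const_mul, ← integral_add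
      ((integrable_dotProduct hd hd).const_mul 2)
      ((integrable_dotProduct hcx hcx).const_mul (2 * c₁))]
    refine integral_mono (integrable_dotProduct hcu hcu)
      (((integrable_dotProduct hd hd).const_mul 2).add
      ((integrable_dotProduct hcx hcx).const_mul (2 * c₁))) fun a => ?_
    have h3 := dotProduct_self_le_of_add (u a - ∫ b, u b ∂μ)
      (((Upsilon d P k)⁻¹ * crossTerm d P k) *ᵥ (x a - ∫ b, x b ∂μ))
    have h4 := h₁ (x a - ∫ b, x b ∂μ)
    simp only [deviation]
    linarith
  have h3 := dotProduct_self_le_of_add (∫ b, u b ∂μ)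
    (((UpsilonBar d P Pi k)⁻¹ * crossTermBar d P Pi k) *ᵥ (∫ b, x b ∂μ))
  have h4 := h₂ (∫ b, x b ∂μ)
  have p1 := meanSq_nonneg (μ := μ) fun a => x a - ∫ b, x b ∂μ
  have p2 := meanSq_nonneg (μ := μ) (deviation d μ P k x u)
  have p3 := dotProduct_self_nonneg' (∫ b, x b ∂μ)
  have p4 := dotProduct_self_nonneg' (meanDeviation d μ P Pi k x u)
  rw [meanSq_eq_center_add hx, meanSq_eq_center_add hu, deviationSq]
  change _ ≤ (2 * c₁ + 2 * c₂ + 2) * (_ + (meanSq μ (deviation d μ P k x u) + _))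
  change _ ≤ 2 * (meanDeviation d μ P Pi k x u ⬝ᵥ meanDeviation d μ P Pi k x u) + _ at h3
  nlinarith [mul_nonneg hc₁ p2, mul_nonneg hc₁ p3, mul_nonneg hc₁ p4, mul_nonneg hc₂ p1,
    mul_nonneg hc₂ p2, mul_nonneg hc₂ p4]

/-- With zero initial state the map from deviations to states is causal: the state at `k` involves
only deviations before `k`, so bounds propagate by induction. -/
theorem exists_meanSq_state_le {ℱ : Filtration ℕ mΩ} {ω : ℕ → Ω → ℝ} (hω : IsNoise μ ℱ ω N)
    (d : Data n m N) (P Pi : ℕ → Matrix (Fin n) (Fin n) ℝ) {k : ℕ} (hk : k ≤ N) :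
    ∃ c : ℝ, 0 ≤ c ∧ ∀ u ∈ admissible μ ℱ m N 0,
      meanSq μ (state d μ ω 0 (fun _ => 0) u k)
        ≤ c * ∑ j ∈ Finset.range k,
          deviationSq d μ P Pi j (state d μ ω 0 (fun _ => 0) u j) (u j) := by
  induction k with
  | zero =>
    refine ⟨0, le_rfl, fun u _ => ?_⟩
    simp [state_of_le d ω _ u le_rfl, meanSq]
  | succ k ih =>
    obtain ⟨c₀, hc₀, h₀⟩ := ih (Nat.le_of_succ_le hk)
    obtain ⟨c₁, hc₁, h₁⟩ := exists_meanSq_step_le hω d hk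
    obtain ⟨c₂, hc₂, h₂⟩ := exists_meanSq_control_le (μ := μ) d P Pi k
    -- The state contributes `c₀`; the control is at most `c₂` times state plus current deviation,
    -- hence `c₂ * (c₀ + 1)`; the step multiplies by `c₁`.
    refine ⟨c₁ * (c₀ + c₂ * (c₀ + 1)), by positivity, fun u hu => ?_⟩
    obtain ⟨hxm, hx⟩ := state_regular hω d (l := 0) (measurable_const (a := (0 : Fin n → ℝ)))
      (memLp_const _) hu k.zero_le (Nat.le_of_succ_le hk)
    obtain ⟨hum, hu'⟩ := hu k k.zero_le hk
    rw [state_succ d ω _ u k.zero_le, Finset.sum_range_succ]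
    have a0 := h₀ u hu
    have a1 := h₁ _ _ hxm hx hum hu'
    have a2 := h₂ _ _ hx hu'
    have p1 := deviationSq_nonneg (μ := μ) d P Pi k (state d μ ω 0 (fun _ => 0) u k) (u k)
    have p2 : 0 ≤ ∑ j ∈ Finset.range k,
        deviationSq d μ P Pi j (state d μ ω 0 (fun _ => 0) u j) (u j) :=
      Finset.sum_nonneg fun j _ => deviationSq_nonneg d P Pi j _ _
    refine a1.trans ?_
    rw [mul_assoc]
    refine mul_le_mul_of_nonneg_left ?_ hc₁
    have a3 := mul_le_mul_of_nonneg_left a0 hc₂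
    nlinarith [mul_nonneg hc₀ p1, mul_nonneg hc₂ p2, mul_nonneg hc₂ (mul_nonneg hc₀ p1)]

theorem exists_energy_le {ℱ : Filtration ℕ mΩ} {ω : ℕ → Ω → ℝ} (hω : IsNoise μ ℱ ω N)
    (d : Data n m N) (P Pi : ℕ → Matrix (Fin n) (Fin n) ℝ) :
    ∃ c : ℝ, 0 < c ∧ ∀ u ∈ admissible μ ℱ m N 0, energy μ N 0 u
      ≤ c * ∑ j ∈ Finset.range N,
        deviationSq d μ P Pi j (state d μ ω 0 (fun _ => 0) u j) (u j) := by
  have h : ∀ k : Fin N, ∃ c : ℝ, 0 ≤ c ∧ ∀ u ∈ admissible μ ℱ m N 0, meanSq μ (u k)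
      ≤ c * ∑ j ∈ Finset.range N,
        deviationSq d μ P Pi j (state d μ ω 0 (fun _ => 0) u j) (u j) := by
    intro k
    obtain ⟨c₀, hc₀, h₀⟩ := exists_meanSq_state_le hω d P Pi k.2.le
    obtain ⟨c₂, hc₂, h₂⟩ := exists_meanSq_control_le (μ := μ) d P Pi k
    refine ⟨c₂ * (c₀ + 1), by positivity, fun u hu => ?_⟩
    have hx := (state_regular hω d (l := 0) (measurable_const (a := (0 : Fin n → ℝ)))
      (memLp_const _) hu k.1.zero_le k.2.le).2
    refine (h₂ _ _ hx (hu k k.1.zero_le k.2).2).trans ?_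
    rw [mul_assoc, add_mul, one_mul]
    have hnn : ∀ j, 0 ≤ deviationSq d μ P Pi j (state d μ ω 0 (fun _ => 0) u j) (u j) :=
      fun j => deviationSq_nonneg d P Pi j _ _
    refine mul_le_mul_of_nonneg_left (add_le_add ((h₀ u hu).trans
      (mul_le_mul_of_nonneg_left ?_ hc₀)) ?_) hc₂
    · exact Finset.sum_le_sum_of_subset_of_nonneg (Finset.range_mono k.2.le) fun j _ _ => hnn j
    · exact Finset.single_le_sum (f := fun j =>
        deviationSq d μ P Pi j (state d μ ω 0 (fun _ => 0) u j) (u j)) (fun j _ => hnn j)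
        (Finset.mem_range.2 k.2)
  choose c hc h using h
  -- The extra `1` makes the constant strictly positive, since `α` is divided by it later.
  refine ⟨∑ k, c k + 1, add_pos_of_nonneg_of_pos (Finset.sum_nonneg fun k _ => hc k) one_pos,
    fun u hu => ?_⟩
  rw [energy_eq_sum hu, ← Finset.range_eq_Ico, ← Fin.sum_univ_eq_sum_range, add_mul,
    Finset.sum_mul]
  refine (Finset.sum_le_sum fun k _ => h k u hu).trans (le_add_of_nonneg_right ?_)
  rw [one_mul]
  exact Finset.sum_nonneg fun j _ => deviationSq_nonneg d P Pi j _ _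

/-- For zero initial state and with the Riccati equations the cost is the sum of the excesses, each
at least `α` times the squared deviation. -/
theorem exists_mul_energy_le_cost {ℱ : Filtration ℕ mΩ} {ω : ℕ → Ω → ℝ}
    (hω : IsNoise μ ℱ ω N) (d : Data n m N) {P Pi : ℕ → Matrix (Fin n) (Fin n) ℝ}
    (hP : ∀ k ≤ N, (P k).IsSymm) (hPi : ∀ k ≤ N, (Pi k).IsSymm) (hPN : P N = d.G)
    (hPiN : Pi N = d.G + d.Gb) {α : ℝ} (hα : 0 < α)
    (hU : ∀ k < N, (Upsilon d P k - α • 1).PosSemidef)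
    (hUb : ∀ k < N, (UpsilonBar d P Pi k - α • 1).PosSemidef)
    (hric : ∀ k < N, P k = riccatiP d P k ∧ Pi k = riccatiPi d P Pi k) :
    ∃ c : ℝ, 0 < c ∧ ∀ u ∈ admissible μ ℱ m N 0,
      c * energy μ N 0 u ≤ cost d μ ω 0 (fun _ => 0) u := by
  obtain ⟨C, hC, h⟩ := exists_energy_le hω d P Pi
  refine ⟨α / C, div_pos hα hC, fun u hu => ?_⟩
  have h0m : Measurable[ℱ 0] fun _ : Ω => (0 : Fin n → ℝ) := measurable_const
  have h0 : MemLp (fun _ : Ω => (0 : Fin n → ℝ)) 2 μ := memLp_const _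
  rw [cost_eq_meanForm_add_sum_excess hω d hP hPi hPN hPiN
      (fun k hk => isUnit_det_of_posSemidef_sub hα (hU k hk))
      (fun k hk => isUnit_det_of_posSemidef_sub hα (hUb k hk)) N.zero_le h0m h0 hu,
    meanForm_const, Matrix.mulVec_zero, zero_dotProduct, zero_add]
  calc α / C * energy μ N 0 u
      ≤ α / C * (C * ∑ j ∈ Finset.range N,
        deviationSq d μ P Pi j (state d μ ω 0 (fun _ => 0) u j) (u j)) :=
        mul_le_mul_of_nonneg_left (h u hu) (div_pos hα hC).le
    _ = ∑ j ∈ Finset.range N,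
        α * deviationSq d μ P Pi j (state d μ ω 0 (fun _ => 0) u j) (u j) := by
        rw [← mul_assoc, div_mul_cancel₀ _ hC.ne', Finset.mul_sum]
    _ ≤ _ := by
        rw [Finset.range_eq_Ico]
        refine Finset.sum_le_sum fun k hk => ?_
        obtain ⟨hlk, hk⟩ := Finset.mem_Ico.1 hk
        rw [← (hric k hk).1, ← (hric k hk).2, sub_self, zero_add]
        exact mul_deviationSq_le_excess d (hU k hk) (hUb k hk)
          (state_regular hω d h0m h0 hu hlk hk.le).2 (hu k hlk hk).2

end Coercivity

/-! ### The cost as a quadratic form in the control. -/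

section Convexity

variable {Ω : Type*} {mΩ : MeasurableSpace Ω} {μ : Measure Ω} {n m N : ℕ}

theorem integral_linearComb {E : Type*} [NormedAddCommGroup E] [NormedSpace ℝ E] {f g : Ω → E}
    (hf : Integrable f μ) (hg : Integrable g μ) (s t : ℝ) :
    ∫ a, (s • f a + t • g a) ∂μ = s • ∫ a, f a ∂μ + t • ∫ a, g a ∂μ := by
  rw [integral_add (f := fun a => s • f a) (g := fun a => t • g a) (hf.smul s) (hg.smul t),
    integral_smul, integral_smul]

theorem integral_linearComb_sub {f g h : Ω → ℝ} (hf : Integrable f μ) (hg : Integrable g μ)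
    (hh : Integrable h μ) (r s t : ℝ) :
    ∫ a, (r * f a + s * g a - t * h a) ∂μ
      = r * ∫ a, f a ∂μ + s * ∫ a, g a ∂μ - t * ∫ a, h a ∂μ := by
  rw [integral_sub (f := fun a => r * f a + s * g a) ((hf.const_mul r).add (hg.const_mul s))
    (hh.const_mul t), integral_const_mul]
  exact congrArg (· - _) (integral_linearComb hf hg r s)

theorem step_linearComb (d : Data n m N) (ω : ℕ → Ω → ℝ) (k : ℕ) {x y : Ω → Fin n → ℝ}
    {u v : Ω → Fin m → ℝ} (hx : Integrable x μ) (hy : Integrable y μ) (hu : Integrable u μ)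
    (hv : Integrable v μ) (s t : ℝ) :
    step d μ ω k (s • x + t • y) (s • u + t • v)
      = s • step d μ ω k x u + t • step d μ ω k y v := by
  funext a
  simp only [step, integral_linearComb hx hy, integral_linearComb hu hv, Pi.add_apply,
    Pi.smul_apply, Matrix.mulVec_add, Matrix.mulVec_smul]
  module

theorem admissible_linearComb {ℱ : Filtration ℕ mΩ} {l : ℕ} {u v : ℕ → Ω → Fin m → ℝ}
    (hu : u ∈ admissible μ ℱ m N l) (hv : v ∈ admissible μ ℱ m N l) (s t : ℝ) :
    s • u + t • v ∈ admissible μ ℱ m N l := fun k h1 h2 =>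
  ⟨((hu k h1 h2).1.const_smul s).add ((hv k h1 h2).1.const_smul t),
    ((hu k h1 h2).2.const_smul s).add ((hv k h1 h2).2.const_smul t)⟩

variable [IsProbabilityMeasure μ]

/-- The zero initial state makes the control-to-state map linear, not merely affine; integrability
is needed because the dynamics contains means. -/
theorem state_linearComb {ℱ : Filtration ℕ mΩ} {ω : ℕ → Ω → ℝ} (hω : IsNoise μ ℱ ω N)
    (d : Data n m N) {u v : ℕ → Ω → Fin m → ℝ} (hu : u ∈ admissible μ ℱ m N 0)
    (hv : v ∈ admissible μ ℱ m N 0) (s t : ℝ) {k : ℕ} (hk : k ≤ N) :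
    state d μ ω 0 (fun _ => 0) (s • u + t • v) k
      = s • state d μ ω 0 (fun _ => 0) u k + t • state d μ ω 0 (fun _ => 0) v k := by
  induction k with
  | zero =>
    simp only [state]
    funext a
    simp
  | succ k ih =>
    have hreg : ∀ w ∈ admissible μ ℱ m N 0,
        Integrable (state d μ ω 0 (fun _ => 0) w k) μ := fun w hw =>
      (state_regular hω d (l := 0) (measurable_const (a := (0 : Fin n → ℝ)))
        (memLp_const _) hw k.zero_le (Nat.le_of_succ_le hk)).2.integrable one_le_two
    simp only [state_succ d ω _ _ k.zero_le]
    rw [ih (Nat.le_of_succ_le hk)]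
    exact step_linearComb d ω k (hreg u hu) (hreg v hv)
      ((hu k k.zero_le hk).2.integrable one_le_two) ((hv k k.zero_le hk).2.integrable one_le_two)
      s t

/-- The constants `r` and `s` stand for the mean terms, which do not depend on the sample point. -/
theorem integrable_costIntegrand {ℱ : Filtration ℕ mΩ} {ω : ℕ → Ω → ℝ} (hω : IsNoise μ ℱ ω N)
    (d : Data n m N) {l : ℕ} (hl : l ≤ N) {ξ : Ω → Fin n → ℝ} (hξm : Measurable[ℱ l] ξ)
    (hξ : MemLp ξ 2 μ) {u : ℕ → Ω → Fin m → ℝ} (hu : u ∈ admissible μ ℱ m N l) (r s : ℝ) :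
    Integrable (fun a => (d.G *ᵥ state d μ ω l ξ u N a) ⬝ᵥ state d μ ω l ξ u N a + r
      + ∑ k ∈ Finset.Ico l N,
        blockForm (d.Q k) (d.S k) (d.R k) (state d μ ω l ξ u k a) (u k a) + s) μ :=
  have hN := (state_regular hω d hξm hξ hu hl le_rfl).2
  (((integrable_dotProduct (memLp_mulVec d.G hN) hN).add (integrable_const r)).add
    (integrable_finsetSum _ fun _ hk => integrable_runningCost hω d hξm hξ hu hk)).add
    (integrable_const s)

/-- States, controls and their means all depend linearly on the control, so the convexity identity
for quadratic forms applies to each term of the cost. -/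
theorem cost_convexComb {ℱ : Filtration ℕ mΩ} {ω : ℕ → Ω → ℝ} (hω : IsNoise μ ℱ ω N)
    (d : Data n m N) {u v : ℕ → Ω → Fin m → ℝ} (hu : u ∈ admissible μ ℱ m N 0)
    (hv : v ∈ admissible μ ℱ m N 0) (t : ℝ) :
    cost d μ ω 0 (fun _ => 0) (t • u + (1 - t) • v)
      = t * cost d μ ω 0 (fun _ => 0) u + (1 - t) * cost d μ ω 0 (fun _ => 0) v
        - t * (1 - t) * cost d μ ω 0 (fun _ => 0) (u - v) := by
  have hsub : u - v = (1 : ℝ) • u + (-1 : ℝ) • v := by module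
  have hw : u - v ∈ admissible μ ℱ m N 0 := hsub ▸ admissible_linearComb hu hv 1 (-1)
  have h0m : Measurable[ℱ 0] fun _ : Ω => (0 : Fin n → ℝ) := measurable_const
  have h0 : MemLp (fun _ : Ω => (0 : Fin n → ℝ)) 2 μ := memLp_const _
  have hxi : ∀ w ∈ admissible μ ℱ m N 0, ∀ k ≤ N,
      Integrable (state d μ ω 0 (fun _ => 0) w k) μ := fun w hw k hk =>
    (state_regular hω d h0m h0 hw k.zero_le hk).2.integrable one_le_two
  have hui : ∀ w ∈ admissible μ ℱ m N 0, ∀ k < N, Integrable (w k) μ := fun w hw k hk =>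
    (hw k k.zero_le hk).2.integrable one_le_two
  have hx1 : ∀ k ≤ N, ∀ a, state d μ ω 0 (fun _ => 0) (t • u + (1 - t) • v) k a
      = t • state d μ ω 0 (fun _ => 0) u k a + (1 - t) • state d μ ω 0 (fun _ => 0) v k a :=
    fun k hk a => by rw [state_linearComb hω d hu hv t (1 - t) hk]; rfl
  have hx2 : ∀ k ≤ N, ∀ a, state d μ ω 0 (fun _ => 0) (u - v) k a
      = state d μ ω 0 (fun _ => 0) u k a - state d μ ω 0 (fun _ => 0) v k a :=
    fun k hk a => by
      rw [hsub, state_linearComb hω d hu hv 1 (-1) hk]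
      simp [sub_eq_add_neg]
  have hm1 : ∀ k ≤ N, ∫ b, state d μ ω 0 (fun _ => 0) (t • u + (1 - t) • v) k b ∂μ
      = t • ∫ b, state d μ ω 0 (fun _ => 0) u k b ∂μ
        + (1 - t) • ∫ b, state d μ ω 0 (fun _ => 0) v k b ∂μ := fun k hk => by
    rw [state_linearComb hω d hu hv t (1 - t) hk]
    exact integral_linearComb (hxi u hu k hk) (hxi v hv k hk) t (1 - t)
  have hm2 : ∀ k ≤ N, ∫ b, state d μ ω 0 (fun _ => 0) (u - v) k b ∂μ
      = ∫ b, state d μ ω 0 (fun _ => 0) u k b ∂μ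
        - ∫ b, state d μ ω 0 (fun _ => 0) v k b ∂μ := fun k hk => by
    simp only [hx2 k hk]
    exact integral_sub (hxi u hu k hk) (hxi v hv k hk)
  have hn1 : ∀ k < N, ∫ b, (t • u + (1 - t) • v) k b ∂μ
      = t • ∫ b, u k b ∂μ + (1 - t) • ∫ b, v k b ∂μ := fun k hk =>
    integral_linearComb (hui u hu k hk) (hui v hv k hk) t (1 - t)
  have hn2 : ∀ k < N, ∫ b, (u - v) k b ∂μ = ∫ b, u k b ∂μ - ∫ b, v k b ∂μ := fun k hk =>
    integral_sub (hui u hu k hk) (hui v hv k hk)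
  have hs1 : ∀ a, ∑ k ∈ Finset.Ico 0 N, blockForm (d.Q k) (d.S k) (d.R k)
        (state d μ ω 0 (fun _ => 0) (t • u + (1 - t) • v) k a) ((t • u + (1 - t) • v) k a)
      = t * ∑ k ∈ Finset.Ico 0 N, blockForm (d.Q k) (d.S k) (d.R k)
          (state d μ ω 0 (fun _ => 0) u k a) (u k a)
        + (1 - t) * ∑ k ∈ Finset.Ico 0 N, blockForm (d.Q k) (d.S k) (d.R k)
          (state d μ ω 0 (fun _ => 0) v k a) (v k a)
        - t * (1 - t) * ∑ k ∈ Finset.Ico 0 N, blockForm (d.Q k) (d.S k) (d.R k)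
          (state d μ ω 0 (fun _ => 0) (u - v) k a) ((u - v) k a) := fun a => by
    rw [Finset.mul_sum, Finset.mul_sum, Finset.mul_sum, ← Finset.sum_add_distrib,
      ← Finset.sum_sub_distrib]
    refine Finset.sum_congr rfl fun k hk => ?_
    have hk := (Finset.mem_Ico.1 hk).2.le
    rw [hx1 k hk, hx2 k hk]
    exact blockForm_convexComb _ _ _ t _ _ _ _
  have hs2 : ∑ k ∈ Finset.Ico 0 N, blockForm (d.Qb k) (d.Sb k) (d.Rb k)
        (∫ b, state d μ ω 0 (fun _ => 0) (t • u + (1 - t) • v) k b ∂μ)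
        (∫ b, (t • u + (1 - t) • v) k b ∂μ)
      = t * ∑ k ∈ Finset.Ico 0 N, blockForm (d.Qb k) (d.Sb k) (d.Rb k)
          (∫ b, state d μ ω 0 (fun _ => 0) u k b ∂μ) (∫ b, u k b ∂μ)
        + (1 - t) * ∑ k ∈ Finset.Ico 0 N, blockForm (d.Qb k) (d.Sb k) (d.Rb k)
          (∫ b, state d μ ω 0 (fun _ => 0) v k b ∂μ) (∫ b, v k b ∂μ)
        - t * (1 - t) * ∑ k ∈ Finset.Ico 0 N, blockForm (d.Qb k) (d.Sb k) (d.Rb k)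
          (∫ b, state d μ ω 0 (fun _ => 0) (u - v) k b ∂μ) (∫ b, (u - v) k b ∂μ) := by
    rw [Finset.mul_sum, Finset.mul_sum, Finset.mul_sum, ← Finset.sum_add_distrib,
      ← Finset.sum_sub_distrib]
    refine Finset.sum_congr rfl fun k hk => ?_
    have hk := (Finset.mem_Ico.1 hk).2
    rw [hm1 k hk.le, hm2 k hk.le, hn1 k hk, hn2 k hk]
    exact blockForm_convexComb _ _ _ t _ _ _ _
  have i1 := integrable_costIntegrand hω d N.zero_le h0m h0 hu
  have i2 := integrable_costIntegrand hω d N.zero_le h0m h0 hv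
  have i3 := integrable_costIntegrand hω d N.zero_le h0m h0 hw
  simp only [cost]
  rw [← integral_linearComb_sub (i1 _ _) (i2 _ _) (i3 _ _)]
  refine integral_congr_ae (ae_of_all _ fun a => ?_)
  dsimp only
  rw [hs1, hs2, hx1 N le_rfl, hx2 N le_rfl, hm1 N le_rfl, hm2 N le_rfl, quadForm_convexComb,
    quadForm_convexComb]
  ring

end Convexity
end MFLQ

theorem theorem5p2 {Ω : Type*} {mΩ : MeasurableSpace Ω} (μ : Measure Ω) [IsProbabilityMeasure μ]
    (ℱ : Filtration ℕ mΩ) (n m N : ℕ) (ω : ℕ → Ω → ℝ) (hω : MFLQ.IsNoise μ ℱ ω N)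
    (hrich : ∃ η : Ω → ℝ, MFLQ.IsInitialState μ ℱ ω N 0 η ∧ ¬ ∃ c : ℝ, η =ᵐ[μ] fun _ => c)
    (d : MFLQ.Data n m N)
    (P Pi : ℕ → Matrix (Fin n) (Fin n) ℝ)
    (hP : ∀ k ≤ N, (P k).IsSymm) (hPi : ∀ k ≤ N, (Pi k).IsSymm)
    (hfin : MFLQ.IsFiniteProblem d μ ℱ ω)
    (hrep : MFLQ.ValueRepresentation d μ ℱ ω P Pi)
    (α : ℝ) (hα : 0 < α)
    (hUpsilon : ∀ k < N, (MFLQ.Upsilon d P k - α • 1).PosSemidef)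
    (hUpsilonBar : ∀ k < N, (MFLQ.UpsilonBar d P Pi k - α • 1).PosSemidef) :
    MFLQ.SolvesGRE d P Pi ∧
      ∃ c : ℝ, 0 < c ∧
        MFLQ.UniformlyConvexWith d μ ℱ ω 0 (fun _ => 0) c ∧
        ∀ u ∈ MFLQ.admissible μ ℱ m N 0,
          c * MFLQ.energy μ N 0 u ≤ MFLQ.cost d μ ω 0 (fun _ => 0) u := by
  obtain ⟨η, hη, hne⟩ := hrich
  obtain ⟨hPN, hPiN⟩ := MFLQ.terminal_of_valueRepresentation hω hη hne d hP hPi hrep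
  have hric : ∀ k < N, P k = MFLQ.riccatiP d P k ∧ Pi k = MFLQ.riccatiPi d P Pi k := fun k hk =>
    MFLQ.riccati_of_valueRepresentation hω hη hne d hP hPi hrep hα hUpsilon hUpsilonBar hk
  refine ⟨⟨fun k hk => ⟨_, MFLQ.isMoorePenrose_inv
      (MFLQ.isUnit_det_of_posSemidef_sub hα (hUpsilon k hk)), (hric k hk).1⟩,
    fun k hk => ⟨_, MFLQ.isMoorePenrose_inv
      (MFLQ.isUnit_det_of_posSemidef_sub hα (hUpsilonBar k hk)), (hric k hk).2⟩, hPN, hPiN⟩, ?_⟩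
  obtain ⟨c, hc, hcost⟩ := MFLQ.exists_mul_energy_le_cost hω d hP hPi hPN hPiN hα hUpsilon
    hUpsilonBar hric
  refine ⟨c, hc, fun u hu v hv t ht => ?_, hcost⟩
  have hw : u - v ∈ MFLQ.admissible μ ℱ m N 0 := by
    have hsub : u - v = (1 : ℝ) • u + (-1 : ℝ) • v := by module
    exact hsub ▸ MFLQ.admissible_linearComb hu hv 1 (-1)
  rw [MFLQ.cost_convexComb hω d hu hv t]
  -- The convexity defect is `t (1 - t)` times the cost of `u - v`, so coercivity at `u - v` gives
  -- the modulus with the same `c`.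
  have h := mul_le_mul_of_nonneg_left (hcost _ hw) (mul_nonneg ht.1 (sub_nonneg.2 ht.2))
  linarith
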